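/- Let $\mathscr A$ be an arbitrary $C^*$-algebra and let $X, Y$ be Hilbert $\mathscr A$-modules, with inner products $\mathscr A$-linear in the second variable. Operators are $\mathbb C$- and $\mathscr A$-linear maps $t:\mathrm{Dom}(t)\subseteq X\to Y$ defined on $\mathscr A$-submodules; $\mathrm{Ran}(t)$ is the range of $t$; $s\subseteq t$ means that $t$ extends $s$; the product $ts$ has domain $\{x\in\mathrm{Dom}(s): s x\in\mathrm{Dom}(t)\}$. The adjoint $t^*$ of a densely defined $t$ has domain $\{y\in Y:\exists z\in X\ \forall x\in\mathrm{Dom}(t),\ \langle tx,y\rangle=\langle x,z\rangle\}$ and $t^*y=z$. An operator $t$ is regular if it is densely defined and closed, $t^*$ is densely defined, and $1+t^*t$ has dense range. For a regular operator $t$ from $X$ to $Y$, a regular operator $s$ from $Y$ to $X$ is a Moore-Penrose inverse of $t$ if $tst=t$, $sts=s$, $(ts)^*=\overline{ts}$ and $(st)^*=\overline{st}$; if there is exactly one, it is denoted $t^\dagger$. Theorem. Let $t$ be a regular operator from $X$ to $Y$ such that $\overline{\mathrm{Ran}(t^*)}$ and $\overline{\mathrm{Ran}(t)}$ are orthogonally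 complemented in $X$ and $Y$, respectively, i.e. $X=\overline{\mathrm{Ran}(t^*)}\oplus\overline{\mathrm{Ran}(t^*)}^{\perp}$ and $Y=\overline{\mathrm{Ran}(t)}\oplus\overline{\mathrm{Ran}(t)}^{\perp}$. Then each of the operators $t$, $tt^*$ and $t^*t$ is regular and has exactly one Moore-Penrose inverse, and (i) $t^*(tt^*)^\dagger\subseteq t^\dagger$; (ii) $t^\dagger\subseteq(t^*t)^\dagger t^*$ if and only if $\mathrm{Ran}(t)\subseteq\mathrm{Dom}(t^*)$. If in addition $t$ has closed range, then (iii) $t^*(tt^*)^\dagger=t^\dagger$; (iv) $t^\dagger=(t^*t)^\dagger t^*$ whenever $\mathrm{Ran}(t)\subseteq\mathrm{Dom}(t^*)$. -/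

import Mathlib

/-!
Hilbert modules over a C⋆-algebra `A` are Mathlib's `CStarModule A X` on a complete normed space
`X`; the `A`-valued inner product is linear in the second variable, and the module laws of the
action of `A` follow from the axioms by nondegeneracy of the inner product.
Mathlib writes the action of `A` on the left; right modules over `A` are the
same thing as left modules over the opposite C⋆-algebra.

Unbounded operators are partially defined `ℂ`-linear maps `X →ₗ.[ℂ] Y`, the operator inclusion
`s ⊆ t` being `s ≤ t`.
-/

namespace HilbertModule

section Composition

variable {X Y Z : Type*} [AddCommGroup X] [Module ℂ X] [AddCommGroup Y] [Module ℂ Y]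
  [AddCommGroup Z] [Module ℂ Z]

/-- The range of a partially defined operator. -/
def ran (t : X →ₗ.[ℂ] Y) : Submodule ℂ Y := LinearMap.range t.toFun

/-- The domain `{x ∈ Dom s | s x ∈ Dom t}` of the composition `t s`. -/
def compDomain (t : Y →ₗ.[ℂ] Z) (s : X →ₗ.[ℂ] Y) : Submodule ℂ X :=
  (t.domain.comap s.toFun).map s.domain.subtype

theorem mem_compDomain {t : Y →ₗ.[ℂ] Z} {s : X →ₗ.[ℂ] Y} {x : X} :
    x ∈ compDomain t s ↔ ∃ h : x ∈ s.domain, s ⟨x, h⟩ ∈ t.domain := by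
  simp [compDomain]

/-- The composition `t s`, with domain `{x ∈ Dom s | s x ∈ Dom t}` and `(t s) x = t (s x)`. -/
noncomputable def comp (t : Y →ₗ.[ℂ] Z) (s : X →ₗ.[ℂ] Y) : X →ₗ.[ℂ] Z where
  domain := compDomain t s
  toFun :=
    { toFun := fun x =>
        t ⟨s ⟨x, (mem_compDomain.1 x.2).1⟩, (mem_compDomain.1 x.2).2⟩
      map_add' := fun x y => by
        rw [← t.map_add]
        congr 1
        exact Subtype.ext (s.map_add ⟨x, (mem_compDomain.1 x.2).1⟩ ⟨y, (mem_compDomain.1 y.2).1⟩)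
      map_smul' := fun c x => by
        rw [RingHom.id_apply, ← t.map_smul]
        congr 1
        exact Subtype.ext (s.map_smul c ⟨x, (mem_compDomain.1 x.2).1⟩) }

end Composition

section Operators

variable (A : Type*) {X Y : Type*} [NonUnitalCStarAlgebra A] [PartialOrder A] [StarOrderedRing A]
  [NormedAddCommGroup X] [NormedSpace ℂ X] [SMul A X] [CStarModule A X]
  [NormedAddCommGroup Y] [NormedSpace ℂ Y] [SMul A Y] [CStarModule A Y]

/-- `t` is `A`-linear: its domain is an `A`-submodule, and `t (a • x) = a • t x`. -/
def IsModuleLinear (t : X →ₗ.[ℂ] Y) : Prop :=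
  ∀ (a : A) (x : t.domain), ∃ h : a • (x : X) ∈ t.domain, t ⟨a • (x : X), h⟩ = a • t x

/-- The set of all pairs `(y, z)` with `⟪t x, y⟫ = ⟪x, z⟫` for all `x ∈ Dom t`. -/
noncomputable def adjointGraph (t : X →ₗ.[ℂ] Y) : Submodule ℂ (Y × X) where
  carrier := {p | ∀ x : t.domain, inner A (t x) p.1 = inner A (x : X) p.2}
  add_mem' := fun {p q} hp hq x => by
    simp only [Prod.fst_add, Prod.snd_add, CStarModule.inner_add_right, hp x, hq x]
  zero_mem' := fun x => by simp
  smul_mem' := fun c p hp x => by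
    simp only [Prod.smul_fst, Prod.smul_snd, CStarModule.inner_smul_right_complex, hp x]

/-- The adjoint `t*` of a densely defined operator: `y ∈ Dom t*` with `t* y = z` exactly if
`⟪t x, y⟫ = ⟪x, z⟫` for all `x ∈ Dom t`. (If `Dom t` is not dense, such a `z` need not be unique,
and the values are junk.) -/
noncomputable def adjoint (t : X →ₗ.[ℂ] Y) : Y →ₗ.[ℂ] X := (adjointGraph A t).toLinearPMap

theorem mem_domain_adjoint {t : X →ₗ.[ℂ] Y} {y : Y} :
    y ∈ (adjoint A t).domain ↔
      ∃ z : X, ∀ x : t.domain, inner A (t x) y = inner A (x : X) z := by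
  simp [adjoint, adjointGraph, Submodule.toLinearPMap_domain]

theorem mem_graph_adjoint {t : X →ₗ.[ℂ] Y} (ht : Dense (t.domain : Set X)) {y : Y} {z : X} :
    (y, z) ∈ (adjoint A t).graph ↔ ∀ x : t.domain, inner A (t x) y = inner A (x : X) z := by
  have key : (adjoint A t).graph = adjointGraph A t := by
    refine Submodule.toLinearPMap_graph_eq _ ?_
    rintro ⟨y, z⟩ hp (rfl : y = 0)
    have h0 : ∀ x : X, inner A x z = 0 := by
      have hc : Continuous fun x : X => inner A x z :=
        (CStarModule.continuous_inner (A := A) (E := X)).comp (continuous_id.prodMk continuous_const)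
      refine fun x => congrFun (hc.ext_on ht continuous_const fun x hx => ?_) x
      have := hp ⟨x, hx⟩
      simpa using this.symm
    exact CStarModule.inner_self.1 (h0 z)
  rw [key]
  rfl

/-- The `A`-valued orthogonal complement `W^⊥` of a subspace `W`. -/
noncomputable def orthogonal (W : Submodule ℂ X) : Submodule ℂ X where
  carrier := {x | ∀ w ∈ W, inner A w x = 0}
  add_mem' := fun {x y} hx hy w hw => by
    simp [hx w hw, hy w hw]
  zero_mem' := fun w _ => by simp
  smul_mem' := fun c x hx w hw => by simp [hx w hw]

/-- `W` is an orthogonal summand: `X = W ⊕ W^⊥`. -/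
def IsOrthogonallyComplemented (W : Submodule ℂ X) : Prop := IsCompl W (orthogonal A W)

/-- Regular operators: `A`-linear, densely defined, closed (the graph is closed in `X × Y`, whose
product topology is the one of the Hilbert module `X ⊕ Y`), adjointable (the adjoint is densely
defined), and such that the range of `1 + t* t` is dense. -/
structure IsRegular (t : X →ₗ.[ℂ] Y) : Prop where
  moduleLinear : IsModuleLinear A t
  dense_domain : Dense (t.domain : Set X)
  isClosed : t.IsClosed
  dense_adjoint_domain : Dense ((adjoint A t).domain : Set Y)
  dense_range : Dense (Set.range fun x : (comp (adjoint A t) t).domain =>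
    (x : X) + comp (adjoint A t) t x)

/-- `s` is a Moore-Penrose inverse of `t`: both are regular, `t s t = t`, `s t s = s`, and
`(t s)*`, `(s t)*` are the closures of `t s`, `s t`. -/
structure IsMoorePenroseInverse (t : X →ₗ.[ℂ] Y) (s : Y →ₗ.[ℂ] X) : Prop where
  regular_left : IsRegular A t
  regular_right : IsRegular A s
  comp_comp_left : comp t (comp s t) = t
  comp_comp_right : comp s (comp t s) = s
  adjoint_left : adjoint A (comp t s) = (comp t s).closure
  adjoint_right : adjoint A (comp s t) = (comp s t).closure

open Classical in
/-- The Moore-Penrose inverse of `t`: the unique operator satisfying `IsMoorePenroseInverse`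
(junk if there is no unique one). -/
noncomputable def moorePenroseInverse (t : X →ₗ.[ℂ] Y) : Y →ₗ.[ℂ] X :=
  if h : ∃! s : Y →ₗ.[ℂ] X, IsMoorePenroseInverse A t s then h.choose else 0

theorem moorePenroseInverse_spec {t : X →ₗ.[ℂ] Y}
    (h : ∃! s : Y →ₗ.[ℂ] X, IsMoorePenroseInverse A t s) :
    IsMoorePenroseInverse A t (moorePenroseInverse A t) := by
  rw [moorePenroseInverse, dif_pos h]
  exact h.choose_spec.1

end Operators

end HilbertModule

/-! Operators are compared through their graphs, so domains need no separate bookkeeping. For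
regular t, X ⊕ Y is the orthogonal sum of the graph of t and the rotated graph {(t* v, -v)}
(`IsRegular.exists_decomposition`). Hence 1 + t* t is onto, t** = t and t* is regular.

Resolvent estimates take the place of functional calculus. T = t* t is positive and T + 1 is onto,
so T + z stays onto along chains of overlapping discs (`IsPositiveOperator.isOnto_of_norm_sub_lt`).
Large real z give density of Dom T, z = ±i make 1 + T² onto and T regular, and small real z show
that t t* and t have ranges with the same closure. So t t* and t* t inherit complemented ranges.

The Moore-Penrose inverse is then forced (`IsMoorePenroseInverse.eq_pseudoInverse`): t† y = x means
that x ∈ Dom t ∩ cl Ran t* and y - t x ⊥ Ran t. In these terms t* (t t*)† asks in addition that x ∈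
Ran t*, and (t* t)† t* that t x ∈ Dom t*; this is the content of (i) and (ii). If Ran t is closed,
t† is bounded and its adjoint solves t* z = x, so the first extra demand is automatic. -/

set_option linter.unusedSectionVars false

namespace HilbertModule

/-! ### Graph calculus for partially defined operators -/

section Graph

variable {X Y Z : Type*} [AddCommGroup X] [Module ℂ X] [AddCommGroup Y] [Module ℂ Y]
  [AddCommGroup Z] [Module ℂ Z]

theorem mem_graph_comp {t : Y →ₗ.[ℂ] Z} {s : X →ₗ.[ℂ] Y} {x : X} {z : Z} :
    (x, z) ∈ (comp t s).graph ↔ ∃ y, (x, y) ∈ s.graph ∧ (y, z) ∈ t.graph := by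
  constructor
  · intro h
    obtain ⟨u, rfl, rfl⟩ := (LinearPMap.mem_graph_iff _).1 h
    have hu := mem_compDomain.1 u.2
    exact ⟨s ⟨u, hu.1⟩, s.mem_graph ⟨u, hu.1⟩, t.mem_graph ⟨s ⟨u, hu.1⟩, hu.2⟩⟩
  · rintro ⟨y, hs, ht⟩
    obtain ⟨u, rfl, rfl⟩ := (LinearPMap.mem_graph_iff _).1 hs
    obtain ⟨v, hv, rfl⟩ := (LinearPMap.mem_graph_iff _).1 ht
    dsimp only at hv
    have hu : (u : X) ∈ compDomain t s := mem_compDomain.2 ⟨u.2, hv ▸ v.2⟩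
    refine (LinearPMap.mem_graph_iff _).2 ⟨⟨u, hu⟩, rfl, ?_⟩
    exact congrArg t (Subtype.ext hv.symm)

theorem mem_ran {t : X →ₗ.[ℂ] Y} {y : Y} : y ∈ ran t ↔ ∃ x, (x, y) ∈ t.graph :=
  LinearPMap.mem_range_iff

theorem mem_ran_of_mem_graph {t : X →ₗ.[ℂ] Y} {x : X} {y : Y} (h : (x, y) ∈ t.graph) :
    y ∈ ran t :=
  mem_ran.2 ⟨x, h⟩

theorem graph_ext {s t : X →ₗ.[ℂ] Y} (h : ∀ x y, (x, y) ∈ s.graph ↔ (x, y) ∈ t.graph) : s = t :=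
  LinearPMap.eq_of_eq_graph (Submodule.ext fun p => h p.1 p.2)

theorem le_of_graph {s t : X →ₗ.[ℂ] Y} (h : ∀ x y, (x, y) ∈ s.graph → (x, y) ∈ t.graph) :
    s ≤ t :=
  LinearPMap.le_of_le_graph fun p => h p.1 p.2

theorem graph_add {t : X →ₗ.[ℂ] Y} {x₁ x₂ : X} {y₁ y₂ : Y} (h₁ : (x₁, y₁) ∈ t.graph)
    (h₂ : (x₂, y₂) ∈ t.graph) : (x₁ + x₂, y₁ + y₂) ∈ t.graph :=
  t.graph.add_mem h₁ h₂

theorem graph_sub {t : X →ₗ.[ℂ] Y} {x₁ x₂ : X} {y₁ y₂ : Y} (h₁ : (x₁, y₁) ∈ t.graph)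
    (h₂ : (x₂, y₂) ∈ t.graph) : (x₁ - x₂, y₁ - y₂) ∈ t.graph :=
  t.graph.sub_mem h₁ h₂

theorem graph_smul {t : X →ₗ.[ℂ] Y} {x : X} {y : Y} (c : ℂ) (h : (x, y) ∈ t.graph) :
    (c • x, c • y) ∈ t.graph :=
  t.graph.smul_mem c h

theorem graph_neg {t : X →ₗ.[ℂ] Y} {x : X} {y : Y} (h : (x, y) ∈ t.graph) :
    (-x, -y) ∈ t.graph :=
  t.graph.neg_mem h

theorem graph_zero (t : X →ₗ.[ℂ] Y) : ((0 : X), (0 : Y)) ∈ t.graph :=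
  t.graph.zero_mem

end Graph

/-! ### Orthogonality and complemented submodules -/

section Inner

variable (A : Type*) {X Y : Type*} [NonUnitalCStarAlgebra A] [PartialOrder A] [StarOrderedRing A]
  [NormedAddCommGroup X] [NormedSpace ℂ X] [SMul A X] [CStarModule A X]
  [NormedAddCommGroup Y] [NormedSpace ℂ Y] [SMul A Y] [CStarModule A Y]

theorem inner_swap {x x' : X} {y y' : Y} (h : inner A x x' = inner A y y') :
    inner A x' x = inner A y' y := by
  rw [← CStarModule.star_inner x x', h, CStarModule.star_inner]

theorem eq_zero_of_inner_self_add {x : X} {y : Y}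
    (h : inner A x x + inner A y y = 0) : x = 0 ∧ y = 0 := by
  have hx : (0 : A) ≤ inner A x x := CStarModule.inner_self_nonneg
  have hy : (0 : A) ≤ inner A y y := CStarModule.inner_self_nonneg
  obtain ⟨h₁, h₂⟩ := (add_eq_zero_iff_of_nonneg hx hy).1 h
  exact ⟨CStarModule.inner_self.1 h₁, CStarModule.inner_self.1 h₂⟩

theorem norm_le_of_inner_le {x : X} {a : A} {c : ℝ} (hc : 0 ≤ c)
    (h : inner A x x ≤ a) (ha : ‖a‖ ≤ c ^ 2) : ‖x‖ ≤ c := by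
  refine (pow_le_pow_iff_left₀ (norm_nonneg x) hc two_ne_zero).1 ?_
  rw [CStarModule.norm_sq_eq A]
  exact (CStarAlgebra.norm_le_norm_of_nonneg_of_le CStarModule.inner_self_nonneg h).trans ha

theorem continuous_inner_left (y : X) : Continuous fun x : X => inner A x y :=
  (CStarModule.continuous_inner (A := A) (E := X)).comp (continuous_id.prodMk continuous_const)

theorem continuous_inner_right (x : X) : Continuous fun y : X => inner A x y :=
  (CStarModule.continuous_inner (A := A) (E := X)).comp (continuous_const.prodMk continuous_id)

theorem mem_orthogonal {W : Submodule ℂ X} {x : X} :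
    x ∈ orthogonal A W ↔ ∀ w ∈ W, inner A w x = 0 :=
  Iff.rfl

theorem inner_left_of_mem_orthogonal {W : Submodule ℂ X} {x w : X} (hx : x ∈ orthogonal A W)
    (hw : w ∈ W) : inner A x w = 0 := by
  rw [← CStarModule.star_inner w x, hx w hw, star_zero]

theorem eq_zero_of_mem_orthogonal {W : Submodule ℂ X} {x : X} (hx : x ∈ orthogonal A W)
    (hw : x ∈ W) : x = 0 :=
  CStarModule.inner_self.1 (hx x hw)

theorem isClosed_orthogonal (W : Submodule ℂ X) : IsClosed (orthogonal A W : Set X) := by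
  have : (orthogonal A W : Set X) = ⋂ w ∈ W, {x | inner A w x = 0} := by
    ext x; simp [mem_orthogonal]
  rw [this]
  exact isClosed_biInter fun w _ => isClosed_eq (continuous_inner_right A w) continuous_const

theorem orthogonal_topologicalClosure (W : Submodule ℂ X) :
    orthogonal A W.topologicalClosure = orthogonal A W := by
  refine le_antisymm (fun x hx w hw => hx w (W.le_topologicalClosure hw)) fun x hx w hw => ?_
  have : IsClosed {w | inner A w x = 0} :=
    isClosed_eq (continuous_inner_left A x) continuous_const
  exact closure_minimal (fun w hw => hx w hw) this hw

/-- cl W and W^⊥ meet only in 0; this identifies two candidates for the same component. -/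
theorem eq_of_sub_mem_orthogonal {W : Submodule ℂ X} {x u : X} (hx : x ∈ W.topologicalClosure)
    (hu : u ∈ W.topologicalClosure) (h : x - u ∈ orthogonal A W) : x = u := by
  rw [← orthogonal_topologicalClosure] at h
  exact sub_eq_zero.1 (eq_zero_of_mem_orthogonal A h (sub_mem hx hu))

/-- An orthogonal summand `cl W` is the range of a continuous orthogonal projection. -/
theorem IsOrthogonallyComplemented.exists_projection [CompleteSpace X] {W : Submodule ℂ X}
    (h : IsOrthogonallyComplemented A W.topologicalClosure) :
    ∃ P : X →L[ℂ] X, ∀ x, P x ∈ W.topologicalClosure ∧ x - P x ∈ orthogonal A W := by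
  have hc := Submodule.IsCompl.isTopCompl_of_isClosed h W.isClosed_topologicalClosure
    (isClosed_orthogonal A _)
  refine ⟨W.topologicalClosure.projectionL _ hc,
    fun x => ⟨Submodule.projectionL_apply_mem hc x, ?_⟩⟩
  rw [← orthogonal_topologicalClosure, ← Submodule.projectionL_apply_eq_zero_iff hc, map_sub,
    Submodule.projectionL_apply_left hc ⟨_, Submodule.projectionL_apply_mem hc x⟩, sub_self]

/-- This is cl W = W^⊥⊥, which can fail without complementability. It turns membership in the
closure into linear equations. -/
theorem IsOrthogonallyComplemented.mem_topologicalClosure_iff [CompleteSpace X]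
    {W : Submodule ℂ X} (h : IsOrthogonallyComplemented A W.topologicalClosure) {x : X} :
    x ∈ W.topologicalClosure ↔ ∀ k ∈ orthogonal A W, inner A k x = 0 := by
  constructor
  · intro hx k hk
    rw [← orthogonal_topologicalClosure] at hk
    exact inner_left_of_mem_orthogonal A hk hx
  · intro hx
    obtain ⟨P, hP⟩ := h.exists_projection
    obtain ⟨h₁, h₂⟩ := hP x
    have h₃ : inner A (x - P x) (P x) = 0 :=
      inner_left_of_mem_orthogonal A (orthogonal_topologicalClosure A W ▸ h₂) h₁
    have : x - P x = 0 := by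
      refine CStarModule.inner_self.1 (?_ : inner A (x - P x) (x - P x) = 0)
      rw [CStarModule.inner_sub_right, hx _ h₂, h₃, sub_zero]
    rw [sub_eq_zero.1 this]
    exact h₁

end Inner

/-! ### Adjoints through graphs -/

section Adjoint

variable (A : Type*) {X Y : Type*} [NonUnitalCStarAlgebra A] [PartialOrder A] [StarOrderedRing A]
  [NormedAddCommGroup X] [NormedSpace ℂ X] [SMul A X] [CStarModule A X]
  [NormedAddCommGroup Y] [NormedSpace ℂ Y] [SMul A Y] [CStarModule A Y]

theorem isModuleLinear_iff {t : X →ₗ.[ℂ] Y} :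
    IsModuleLinear A t ↔ ∀ (a : A) (x : X) (y : Y), (x, y) ∈ t.graph →
      (a • x, a • y) ∈ t.graph := by
  constructor
  · intro h a x y hxy
    obtain ⟨u, rfl, rfl⟩ := (LinearPMap.mem_graph_iff _).1 hxy
    obtain ⟨h₁, h₂⟩ := h a u
    exact (LinearPMap.mem_graph_iff _).2 ⟨⟨_, h₁⟩, rfl, h₂⟩
  · intro h a x
    obtain ⟨⟨u, hu⟩, h₁, h₂⟩ := (LinearPMap.mem_graph_iff _).1 (h a x (t x) (t.mem_graph x))
    dsimp only at h₁ h₂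
    subst h₁
    exact ⟨hu, h₂⟩

theorem mem_graph_adjoint_iff {t : X →ₗ.[ℂ] Y} (ht : Dense (t.domain : Set X)) {y : Y} {z : X} :
    (y, z) ∈ (adjoint A t).graph ↔ ∀ u v, (u, v) ∈ t.graph → inner A v y = inner A u z := by
  rw [mem_graph_adjoint A ht]
  constructor
  · intro h u v huv
    obtain ⟨x, rfl, rfl⟩ := (LinearPMap.mem_graph_iff _).1 huv
    exact h x
  · exact fun h x => h _ _ (t.mem_graph x)

theorem isClosed_adjoint {t : X →ₗ.[ℂ] Y} (ht : Dense (t.domain : Set X)) :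
    (adjoint A t).IsClosed := by
  have : ((adjoint A t).graph : Set (Y × X)) =
      ⋂ x : t.domain, {p | inner A (t x) p.1 = inner A (x : X) p.2} := by
    ext ⟨y, z⟩
    rw [SetLike.mem_coe, mem_graph_adjoint A ht]
    simp
  rw [LinearPMap.IsClosed, this]
  exact isClosed_iInter fun x => isClosed_eq
    ((continuous_inner_right A (t x)).comp continuous_fst)
    ((continuous_inner_right A (x : X)).comp continuous_snd)

theorem isModuleLinear_adjoint {t : X →ₗ.[ℂ] Y} (ht : Dense (t.domain : Set X)) :
    IsModuleLinear A (adjoint A t) := by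
  rw [isModuleLinear_iff]
  intro a y z h
  rw [mem_graph_adjoint_iff A ht] at h ⊢
  intro u v huv
  rw [CStarModule.inner_op_smul_right, CStarModule.inner_op_smul_right, h u v huv]

theorem isModuleLinear_comp {Z : Type*} [NormedAddCommGroup Z] [NormedSpace ℂ Z] [SMul A Z]
    [CStarModule A Z] {t : Y →ₗ.[ℂ] Z} {s : X →ₗ.[ℂ] Y} (ht : IsModuleLinear A t)
    (hs : IsModuleLinear A s) : IsModuleLinear A (comp t s) := by
  rw [isModuleLinear_iff] at *
  intro a x z h
  obtain ⟨y, h₁, h₂⟩ := mem_graph_comp.1 h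
  exact mem_graph_comp.2 ⟨_, hs a _ _ h₁, ht a _ _ h₂⟩

end Adjoint

/-! ### Graph decomposition and regularity of the adjoint -/

section Regular

variable {A : Type*} {X Y : Type*} [NonUnitalCStarAlgebra A] [PartialOrder A] [StarOrderedRing A]
  [NormedAddCommGroup X] [NormedSpace ℂ X] [SMul A X] [CStarModule A X]
  [NormedAddCommGroup Y] [NormedSpace ℂ Y] [SMul A Y] [CStarModule A Y]

theorem IsRegular.inner_eq {t : X →ₗ.[ℂ] Y} (ht : IsRegular A t) {x z : X} {y w : Y}
    (h : (x, y) ∈ t.graph) (h' : (w, z) ∈ (adjoint A t).graph) :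
    inner A y w = inner A x z :=
  (mem_graph_adjoint_iff A ht.dense_domain).1 h' x y h

theorem IsRegular.inner_eq' {t : X →ₗ.[ℂ] Y} (ht : IsRegular A t) {x z : X} {y w : Y}
    (h : (x, y) ∈ t.graph) (h' : (w, z) ∈ (adjoint A t).graph) :
    inner A w y = inner A z x :=
  inner_swap A (ht.inner_eq h h')

/-- The graphs of `t` and of `-t*` are orthogonal to each other. -/
theorem IsRegular.inner_add_inner {t : X →ₗ.[ℂ] Y} (ht : IsRegular A t) {u v' : X} {u' v : Y}
    (h : (u, u') ∈ t.graph) (h' : (v, v') ∈ (adjoint A t).graph) :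
    inner A (u + v') (u + v') + inner A (u' - v) (u' - v) =
      (inner A u u + inner A u' u') + (inner A v v + inner A v' v') := by
  simp only [CStarModule.inner_add_right, CStarModule.inner_add_left, CStarModule.inner_sub_right,
    CStarModule.inner_sub_left, ht.inner_eq h h', ht.inner_eq' h h']
  abel

/-- By orthogonality each of the four squares is dominated by the squared length of the sum, at most
2c²; the constant 2 is a crude √2. -/
theorem IsRegular.norm_le_decomposition {t : X →ₗ.[ℂ] Y} (ht : IsRegular A t) {u v' : X} {u' v : Y}
    (h : (u, u') ∈ t.graph) (h' : (v, v') ∈ (adjoint A t).graph) {c : ℝ}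
    (hc₁ : ‖u + v'‖ ≤ c) (hc₂ : ‖u' - v‖ ≤ c) :
    (‖u‖ ≤ 2 * c ∧ ‖u'‖ ≤ 2 * c) ∧ (‖v‖ ≤ 2 * c ∧ ‖v'‖ ≤ 2 * c) := by
  have hc : 0 ≤ c := (norm_nonneg _).trans hc₁
  have key := ht.inner_add_inner h h'
  have hu : (0 : A) ≤ inner A u u := CStarModule.inner_self_nonneg
  have hu' : (0 : A) ≤ inner A u' u' := CStarModule.inner_self_nonneg
  have hv : (0 : A) ≤ inner A v v := CStarModule.inner_self_nonneg
  have hv' : (0 : A) ≤ inner A v' v' := CStarModule.inner_self_nonneg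
  have hn : ‖(inner A u u + inner A u' u') + (inner A v v + inner A v' v')‖ ≤ (2 * c) ^ 2 := by
    rw [← key]
    refine (norm_add_le _ _).trans ?_
    rw [← CStarModule.norm_sq_eq A, ← CStarModule.norm_sq_eq A]
    nlinarith [pow_le_pow_left₀ (norm_nonneg _) hc₁ 2, pow_le_pow_left₀ (norm_nonneg _) hc₂ 2]
  have h2 : 0 ≤ 2 * c := by linarith
  refine ⟨⟨?_, ?_⟩, ?_, ?_⟩ <;> refine norm_le_of_inner_le A h2 ?_ hn
  · rw [add_assoc]; exact le_add_of_nonneg_right (by positivity)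
  · rw [add_comm (inner A u u), add_assoc]; exact le_add_of_nonneg_right (by positivity)
  · rw [add_comm, add_assoc]; exact le_add_of_nonneg_right (by positivity)
  · rw [add_comm, add_comm (inner A v v), add_assoc]
    exact le_add_of_nonneg_right (by positivity)

/-- The graph of a regular operator is an orthogonal summand of `X ⊕ Y`. -/
theorem IsRegular.exists_decomposition [CompleteSpace X] [CompleteSpace Y] {t : X →ₗ.[ℂ] Y}
    (ht : IsRegular A t) (a : X) (b : Y) :
    ∃ u u' v v', (u, u') ∈ t.graph ∧ (v, v') ∈ (adjoint A t).graph ∧ u + v' = a ∧ u' - v = b := by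
  let S := t.graph
  let S' := (adjoint A t).graph
  have : CompleteSpace S := ht.isClosed.completeSpace_coe
  have : CompleteSpace S' :=
    (isClosed_adjoint A ht.dense_domain : IsClosed (S' : Set (Y × X))).completeSpace_coe
  let p : S × S' →L[ℂ] X × Y := S.subtypeL ∘L ContinuousLinearMap.fst ℂ S S'
  let q : S × S' →L[ℂ] Y × X := S'.subtypeL ∘L ContinuousLinearMap.snd ℂ S S'
  let L : S × S' →L[ℂ] X × Y :=
    (ContinuousLinearMap.fst ℂ X Y ∘L p + ContinuousLinearMap.snd ℂ Y X ∘L q).prod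
      (ContinuousLinearMap.snd ℂ X Y ∘L p - ContinuousLinearMap.fst ℂ Y X ∘L q)
  have hL : AntilipschitzWith 2 L := by
    refine L.antilipschitz_of_bound fun r => ?_
    obtain ⟨⟨⟨u, u'⟩, hu⟩, ⟨⟨v, v'⟩, hv⟩⟩ := r
    obtain ⟨⟨h₁, h₂⟩, h₃, h₄⟩ := ht.norm_le_decomposition hu hv
      (norm_fst_le (L (⟨(u, u'), hu⟩, ⟨(v, v'), hv⟩)))
      (norm_snd_le (L (⟨(u, u'), hu⟩, ⟨(v, v'), hv⟩)))
    exact max_le (max_le h₁ h₂) (max_le h₃ h₄)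
  have hcl : IsClosed ((LinearMap.range (L : S × S' →ₗ[ℂ] X × Y) : Submodule ℂ (X × Y)) :
      Set (X × Y)) := hL.isClosed_range L.uniformContinuous
  set R : Submodule ℂ (X × Y) := LinearMap.range (L : S × S' →ₗ[ℂ] X × Y) with hR
  have hmem : ∀ {u u' v v'}, (u, u') ∈ t.graph → (v, v') ∈ (adjoint A t).graph →
      (u + v', u' - v) ∈ R :=
    fun {u u' v v'} h h' => ⟨(⟨(u, u'), h⟩, ⟨(v, v'), h'⟩), rfl⟩
  -- The range of 1 + t* t enters with v = u' = t u, where the second coordinate cancels.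
  have hX : ∀ x : X, (x, (0 : Y)) ∈ R := by
    have hc : IsClosed {x : X | (x, (0 : Y)) ∈ R} := hcl.preimage (by fun_prop)
    refine fun x => closure_minimal ?_ hc (ht.dense_range x)
    rintro _ ⟨x, rfl⟩
    obtain ⟨y, h₁, h₂⟩ := mem_graph_comp.1 ((comp (adjoint A t) t).mem_graph x)
    simpa using hmem h₁ h₂
  have hY : ∀ y : Y, ((0 : X), y) ∈ R := by
    have hc : IsClosed {y : Y | ((0 : X), y) ∈ R} := hcl.preimage (by fun_prop)
    refine fun y => closure_minimal ?_ hc (ht.dense_adjoint_domain y)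
    intro y hy
    obtain ⟨z, hz⟩ := LinearPMap.mem_domain_iff.1 hy
    simpa using R.sub_mem (hX z) (hmem (graph_zero t) hz)
  have hab : (a, b) ∈ R := by simpa using R.add_mem (hX a) (hY b)
  obtain ⟨⟨⟨⟨u, u'⟩, hu⟩, ⟨⟨v, v'⟩, hv⟩⟩, h⟩ := hab
  exact ⟨u, u', v, v', hu, hv, congrArg Prod.fst h, congrArg Prod.snd h⟩

theorem IsRegular.exists_add_eq [CompleteSpace X] [CompleteSpace Y] {t : X →ₗ.[ℂ] Y}
    (ht : IsRegular A t) (x : X) : ∃ u u', (u, u') ∈ (comp (adjoint A t) t).graph ∧ u + u' = x := by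
  obtain ⟨u, u', v, v', h, h', rfl, h0⟩ := ht.exists_decomposition x 0
  obtain rfl := sub_eq_zero.1 h0
  exact ⟨u, v', mem_graph_comp.2 ⟨u', h, h'⟩, rfl⟩

theorem IsRegular.adjoint_adjoint [CompleteSpace X] [CompleteSpace Y] {t : X →ₗ.[ℂ] Y}
    (ht : IsRegular A t) : adjoint A (adjoint A t) = t := by
  refine graph_ext fun x y => ?_
  rw [mem_graph_adjoint_iff A ht.dense_adjoint_domain]
  refine ⟨fun hxy => ?_, fun hxy u v huv => (ht.inner_eq' hxy huv).symm⟩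
  obtain ⟨u, u', v, v', h, h', rfl, rfl⟩ := ht.exists_decomposition x y
  have key := hxy v v' h'
  rw [CStarModule.inner_add_right, CStarModule.inner_sub_right, ht.inner_eq' h h'] at key
  have h0 : inner A v v + inner A v' v' = 0 := by
    rw [sub_eq_add_neg, add_left_cancel_iff] at key
    rw [key, add_neg_cancel]
  obtain ⟨rfl, rfl⟩ := eq_zero_of_inner_self_add A h0
  simpa using h

theorem dense_range_one_add_of_forall {s : X →ₗ.[ℂ] X}
    (h : ∀ x, ∃ u u', (u, u') ∈ s.graph ∧ u + u' = x) :
    Dense (Set.range fun x : s.domain => (x : X) + s x) := by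
  refine dense_iff_closure_eq.2 (Set.eq_univ_of_forall fun x => subset_closure ?_)
  obtain ⟨u, u', hu, rfl⟩ := h x
  obtain ⟨w, rfl, rfl⟩ := (LinearPMap.mem_graph_iff _).1 hu
  exact ⟨w, rfl⟩

theorem IsRegular.adjoint [CompleteSpace X] [CompleteSpace Y] {t : X →ₗ.[ℂ] Y}
    (ht : IsRegular A t) : IsRegular A (adjoint A t) where
  moduleLinear := isModuleLinear_adjoint A ht.dense_domain
  dense_domain := ht.dense_adjoint_domain
  isClosed := isClosed_adjoint A ht.dense_domain
  dense_adjoint_domain := by rw [ht.adjoint_adjoint]; exact ht.dense_domain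
  dense_range := by
    refine dense_range_one_add_of_forall fun y => ?_
    rw [ht.adjoint_adjoint]
    obtain ⟨u, u', v, v', h, h', h0, rfl⟩ := ht.exists_decomposition 0 y
    -- Splitting (0, y) gives t* (-v) = u and t u = u', hence (1 + t t*)(-v) = y.
    refine ⟨-v, u', mem_graph_comp.2 ⟨u, ?_, h⟩, by abel⟩
    rw [eq_neg_of_add_eq_zero_left h0]
    exact graph_neg h'

end Regular

/-! ### Surjectivity of T + z for positive T -/

section Positive

variable {A : Type*} {X : Type*} [NonUnitalCStarAlgebra A] [PartialOrder A] [StarOrderedRing A]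
  [NormedAddCommGroup X] [NormedSpace ℂ X] [SMul A X] [CStarModule A X]

variable (A) in
/-- `T` is positive: `0 ≤ ⟪x, T x⟫` for all `x ∈ Dom T`. -/
def IsPositiveOperator (T : X →ₗ.[ℂ] X) : Prop :=
  ∀ x x', (x, x') ∈ T.graph → (0 : A) ≤ inner A x x'

/-- `T + z` maps onto `X`. -/
def IsOnto (T : X →ₗ.[ℂ] X) (z : ℂ) : Prop :=
  ∀ y, ∃ x x', (x, x') ∈ T.graph ∧ x' + z • x = y

/-- Expanding the square gives |z|² ⟪x, x⟫ + ⟪x', x'⟫ + 2 Re z ⟪x, x'⟫, whose last two terms are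
positive. -/
theorem IsPositiveOperator.norm_mul_le {T : X →ₗ.[ℂ] X} (hT : IsPositiveOperator A T) {z : ℂ}
    (hz : 0 ≤ z.re) {x x' : X} (h : (x, x') ∈ T.graph) : ‖z‖ * ‖x‖ ≤ ‖x' + z • x‖ := by
  rw [← norm_smul]
  refine norm_le_of_inner_le A (a := inner A (x' + z • x) (x' + z • x)) (norm_nonneg _) ?_
    (CStarModule.norm_sq_eq A).ge
  have hpos := hT x x' h
  have hsymm : inner A x' x = inner A x x' := by
    rw [← CStarModule.star_inner x x']; exact hpos.isSelfAdjoint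
  have key : inner A (x' + z • x) (x' + z • x) =
      inner A (z • x) (z • x) + (inner A x' x' + (2 * z.re) • inner A x x') := by
    have : ((2 * z.re : ℝ) : ℂ) = z + star z := by
      rw [Complex.star_def, Complex.add_conj]
    rw [← Complex.coe_smul, this]
    simp only [CStarModule.inner_add_right, CStarModule.inner_add_left,
      CStarModule.inner_smul_right_complex, CStarModule.inner_smul_left_complex, hsymm,
      add_smul, smul_add]
    abel
  rw [key]
  exact le_add_of_nonneg_right (add_nonneg CStarModule.inner_self_nonneg
    (smul_nonneg (by linarith) hpos))

/-- With R a right inverse of T + z, a solution of (T + w) x = y is a fixed point of x ↦ R (y + (z -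
w) x), a contraction with constant |w - z| / |z|. -/
theorem IsPositiveOperator.isOnto_of_norm_sub_lt [CompleteSpace X] {T : X →ₗ.[ℂ] X}
    (hT : IsPositiveOperator A T) {z w : ℂ} (hz : 0 ≤ z.re) (h : IsOnto T z)
    (hw : ‖w - z‖ < ‖z‖) : IsOnto T w := by
  intro y
  choose R R' hR hR' using h
  have hz0 : 0 < ‖z‖ := (norm_nonneg _).trans_lt hw
  have hlip : ∀ a b, ‖R a - R b‖ ≤ ‖a - b‖ / ‖z‖ := by
    intro a b
    rw [le_div_iff₀' hz0]
    refine (hT.norm_mul_le hz (graph_sub (hR a) (hR b))).trans_eq ?_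
    conv_rhs => rw [← hR' a, ← hR' b]
    rw [smul_sub]; congr 1; abel
  let K : NNReal := ⟨‖w - z‖ / ‖z‖, by positivity⟩
  have hc : ContractingWith K fun x => R (y + (z - w) • x) := by
    refine ⟨?_, LipschitzWith.of_dist_le_mul fun a b => ?_⟩
    · rw [← NNReal.coe_lt_coe]
      exact (div_lt_one hz0).2 hw
    · rw [dist_eq_norm, dist_eq_norm]
      refine (hlip _ _).trans_eq ?_
      rw [add_sub_add_left_eq_sub, ← smul_sub, norm_smul, norm_sub_rev z w]
      exact (div_mul_eq_mul_div _ _ _).symm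
  have hfix : R (y + (z - w) • hc.fixedPoint) = hc.fixedPoint := hc.fixedPoint_isFixedPt
  have h₁ := hR (y + (z - w) • hc.fixedPoint)
  have h₂ := hR' (y + (z - w) • hc.fixedPoint)
  rw [hfix] at h₁ h₂
  refine ⟨_, _, h₁, ?_⟩
  rw [eq_sub_of_add_eq h₂, sub_smul]
  abel

theorem IsPositiveOperator.isOnto_nat [CompleteSpace X] {T : X →ₗ.[ℂ] X}
    (hT : IsPositiveOperator A T) (h : IsOnto T 1) (n : ℕ) : IsOnto T (1 + n / 2 : ℝ) := by
  induction n with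
  | zero => simpa using h
  | succ n ih =>
    refine hT.isOnto_of_norm_sub_lt ?_ ih ?_
    · rw [Complex.ofReal_re]; positivity
    · rw [← Complex.ofReal_sub, Complex.norm_real, Complex.norm_real, Real.norm_eq_abs,
        Real.norm_eq_abs, abs_of_nonneg (by push_cast; linarith), abs_of_nonneg (by positivity)]
      push_cast
      have : (0 : ℝ) ≤ n := n.cast_nonneg
      linarith

theorem IsPositiveOperator.isOnto_of_pos [CompleteSpace X] {T : X →ₗ.[ℂ] X}
    (hT : IsPositiveOperator A T) (h : IsOnto T 1) {r : ℝ} (hr : 0 < r) : IsOnto T r := by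
  obtain ⟨n, hn⟩ := exists_nat_gt r
  -- The disc about 1 + n/2 through the origin contains the interval (0, n + 2).
  refine hT.isOnto_of_norm_sub_lt ?_ (hT.isOnto_nat h n) ?_
  · rw [Complex.ofReal_re]; positivity
  · rw [← Complex.ofReal_sub, Complex.norm_real, Complex.norm_real, Real.norm_eq_abs,
      Real.norm_eq_abs, abs_of_nonneg (by positivity : (0 : ℝ) ≤ 1 + n / 2), abs_lt]
    constructor <;> linarith

theorem IsPositiveOperator.isOnto_imaginary [CompleteSpace X] {T : X →ₗ.[ℂ] X}
    (hT : IsPositiveOperator A T) (h : IsOnto T 1) {s : ℝ} (hs : s ^ 2 = 1) :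
    IsOnto T (s * Complex.I) := by
  -- A direct jump from 1 to ±i has length √2 > 1, so an intermediate centre is needed.
  have h₁ : IsOnto T (3 / 4 + 3 / 4 * s * Complex.I) := by
    refine hT.isOnto_of_norm_sub_lt (by simp) h ?_
    refine lt_of_pow_lt_pow_left₀ 2 (norm_nonneg _) ?_
    rw [Complex.sq_norm, Complex.sq_norm, Complex.normSq_apply, Complex.normSq_apply]
    norm_num
    nlinarith
  refine hT.isOnto_of_norm_sub_lt (by norm_num) h₁ ?_
  refine lt_of_pow_lt_pow_left₀ 2 (norm_nonneg _) ?_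
  rw [Complex.sq_norm, Complex.sq_norm, Complex.normSq_apply, Complex.normSq_apply]
  norm_num
  nlinarith

end Positive

/-! ### Regularity of t* t and t t* -/

section Modulus

variable {A : Type*} {X Y : Type*} [NonUnitalCStarAlgebra A] [PartialOrder A] [StarOrderedRing A]
  [NormedAddCommGroup X] [NormedSpace ℂ X] [SMul A X] [CStarModule A X] [CompleteSpace X]
  [NormedAddCommGroup Y] [NormedSpace ℂ Y] [SMul A Y] [CStarModule A Y] [CompleteSpace Y]

theorem IsRegular.isPositiveOperator {t : X →ₗ.[ℂ] Y} (ht : IsRegular A t) :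
    IsPositiveOperator A (comp (HilbertModule.adjoint A t) t) := by
  intro x x' h
  obtain ⟨y, h₁, h₂⟩ := mem_graph_comp.1 h
  rw [← ht.inner_eq h₁ h₂]
  exact CStarModule.inner_self_nonneg

theorem IsRegular.isOnto_one {t : X →ₗ.[ℂ] Y} (ht : IsRegular A t) :
    IsOnto (comp (HilbertModule.adjoint A t) t) 1 := by
  intro y
  obtain ⟨u, u', h, rfl⟩ := ht.exists_add_eq y
  exact ⟨u, u', h, by rw [one_smul, add_comm]⟩

theorem IsRegular.symm_comp {t : X →ₗ.[ℂ] Y} (ht : IsRegular A t) {x x' u u' : X}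
    (hx : (x, x') ∈ (comp (HilbertModule.adjoint A t) t).graph)
    (hu : (u, u') ∈ (comp (HilbertModule.adjoint A t) t).graph) :
    inner A x' u = inner A x u' := by
  obtain ⟨y, hy, hy'⟩ := mem_graph_comp.1 hx
  obtain ⟨v, hv, hv'⟩ := mem_graph_comp.1 hu
  rw [← ht.inner_eq hy hv', ht.inner_eq' hv hy']

/-- `Dom (t* t)` is dense. -/
theorem IsRegular.dense_domain_comp {t : X →ₗ.[ℂ] Y} (ht : IsRegular A t) :
    Dense ((comp (HilbertModule.adjoint A t) t).domain : Set X) := by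
  refine dense_iff_closure_eq.2 (Set.eq_univ_of_univ_subset ?_)
  rw [← ht.dense_domain.closure_eq]
  refine closure_minimal (fun x hx => ?_) isClosed_closure
  obtain ⟨y, hy⟩ := LinearPMap.mem_domain_iff.1 hx
  rw [Metric.mem_closure_iff]
  intro ε hε
  -- If (T + n) u = x and v = t u, then x - n u = T u, and ⟪T u, T u⟫ + n ⟪v, v⟫ = ⟪v, y⟫ yields ‖T
  -- u‖² ≤ ‖y‖² / n.
  obtain ⟨n, hn⟩ := exists_nat_gt ((‖y‖ / ε) ^ 2)
  have hn0 : (0 : ℝ) < n := (sq_nonneg _).trans_lt hn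
  obtain ⟨u, u', hu, hx'⟩ := ht.isPositiveOperator.isOnto_of_pos ht.isOnto_one hn0 x
  obtain ⟨v, hv, hv'⟩ := mem_graph_comp.1 hu
  refine ⟨((n : ℝ) : ℂ) • u, LinearPMap.mem_domain_of_mem_graph (graph_smul _ hu), ?_⟩
  rw [dist_eq_norm, ← hx', add_sub_cancel_right]
  have key : inner A u' u' + (n : ℝ) • inner A v v = inner A v y := by
    rw [ht.inner_eq' hy hv', ← hx', CStarModule.inner_add_right,
      CStarModule.inner_smul_right_complex, Complex.coe_smul, ht.inner_eq' hv hv']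
  have hu0 : (0 : A) ≤ inner A u' u' := CStarModule.inner_self_nonneg
  have hv0 : (0 : A) ≤ (n : ℝ) • inner A v v := smul_nonneg hn0.le CStarModule.inner_self_nonneg
  have h₁ : n * ‖v‖ ^ 2 ≤ ‖v‖ * ‖y‖ := by
    have := CStarAlgebra.norm_le_norm_of_nonneg_of_le hv0 (le_add_of_nonneg_left hu0)
    rw [key, norm_smul, ← CStarModule.norm_sq_eq A, Real.norm_of_nonneg hn0.le] at this
    exact this.trans (CStarModule.norm_inner_le Y)
  have h₂ : ‖u'‖ ^ 2 ≤ ‖v‖ * ‖y‖ := by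
    have := CStarAlgebra.norm_le_norm_of_nonneg_of_le hu0 (le_add_of_nonneg_right hv0)
    rw [key, ← CStarModule.norm_sq_eq A] at this
    exact this.trans (CStarModule.norm_inner_le Y)
  have h₃ : n * ‖v‖ ≤ ‖y‖ := by
    rcases (norm_nonneg v).eq_or_lt' with h0 | h0
    · rw [h0, mul_zero]; exact norm_nonneg y
    · refine le_of_mul_le_mul_left ?_ h0
      linarith
  refine lt_of_pow_lt_pow_left₀ 2 hε.le (lt_of_mul_lt_mul_left ?_ hn0.le)
  have h₄ : ‖y‖ ^ 2 < n * ε ^ 2 := by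
    rwa [div_pow, div_lt_iff₀ (by positivity)] at hn
  nlinarith [norm_nonneg y, mul_le_mul_of_nonneg_left h₂ hn0.le]

/-- `t* t` is self-adjoint. -/
theorem IsRegular.adjoint_comp {t : X →ₗ.[ℂ] Y} (ht : IsRegular A t) :
    HilbertModule.adjoint A (comp (HilbertModule.adjoint A t) t) =
      comp (HilbertModule.adjoint A t) t := by
  refine graph_ext fun y z => ?_
  rw [mem_graph_adjoint_iff A ht.dense_domain_comp]
  refine ⟨fun h => ?_, fun h u v huv => ht.symm_comp huv h⟩
  obtain ⟨u, u', hu, huy⟩ := ht.exists_add_eq (y + z)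
  -- y - u is orthogonal to the range of 1 + T, which is all of X.
  have hy : y - u = 0 := by
    obtain ⟨x, x', hx, hxy⟩ := ht.exists_add_eq (y - u)
    refine CStarModule.inner_self.1 (?_ : inner A (y - u) (y - u) = 0)
    nth_rw 1 [← hxy]
    have h₁ : inner A (x + x') y = inner A x (y + z) := by
      rw [CStarModule.inner_add_left, h x x' hx, CStarModule.inner_add_right]
    have h₂ : inner A (x + x') u = inner A x (u + u') := by
      rw [CStarModule.inner_add_left, ht.symm_comp hx hu, CStarModule.inner_add_right]
    rw [CStarModule.inner_sub_right, h₁, h₂, huy, sub_self]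
  obtain rfl := sub_eq_zero.1 hy
  rwa [← add_left_cancel huy]

theorem IsRegular.comp_adjoint_self {t : X →ₗ.[ℂ] Y} (ht : IsRegular A t) :
    IsRegular A (comp (HilbertModule.adjoint A t) t) where
  moduleLinear := isModuleLinear_comp A ht.adjoint.moduleLinear ht.moduleLinear
  dense_domain := ht.dense_domain_comp
  isClosed := by
    have := isClosed_adjoint A ht.dense_domain_comp
    rwa [ht.adjoint_comp] at this
  dense_adjoint_domain := by rw [ht.adjoint_comp]; exact ht.dense_domain_comp
  dense_range := by
    rw [ht.adjoint_comp]
    refine dense_range_one_add_of_forall fun y => ?_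
    -- 1 + T² = (T + i)(T - i): the outer factor is solved first, and T u = v + i u again lies in
    -- Dom T.
    obtain ⟨v, v', hv, hy⟩ :=
      ht.isPositiveOperator.isOnto_imaginary ht.isOnto_one (s := 1) (by norm_num) y
    obtain ⟨u, u', hu, huv⟩ :=
      ht.isPositiveOperator.isOnto_imaginary ht.isOnto_one (s := -1) (by norm_num) v
    have hu' : u' = v + Complex.I • u := by rw [← huv]; simp
    have h := graph_add hv (graph_smul Complex.I hu)
    rw [← hu'] at h
    refine ⟨u, _, mem_graph_comp.2 ⟨u', hu, h⟩, ?_⟩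
    rw [← hy, hu', smul_add, smul_smul, Complex.I_mul_I]
    simp
    abel

theorem IsRegular.comp_self_adjoint {t : X →ₗ.[ℂ] Y} (ht : IsRegular A t) :
    IsRegular A (comp t (HilbertModule.adjoint A t)) := by
  have := ht.adjoint.comp_adjoint_self
  rwa [ht.adjoint_adjoint] at this

theorem IsRegular.adjoint_comp_self_adjoint {t : X →ₗ.[ℂ] Y} (ht : IsRegular A t) :
    HilbertModule.adjoint A (comp t (HilbertModule.adjoint A t)) =
      comp t (HilbertModule.adjoint A t) := by
  have := ht.adjoint.adjoint_comp
  rwa [ht.adjoint_adjoint] at this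

/-- `t` and `t t*` have the same closure of the range. -/
theorem IsRegular.topologicalClosure_ran_comp {t : X →ₗ.[ℂ] Y} (ht : IsRegular A t) :
    (ran (comp t (HilbertModule.adjoint A t))).topologicalClosure =
      (ran t).topologicalClosure := by
  refine le_antisymm (Submodule.topologicalClosure_mono fun z hz => ?_)
    (Submodule.topologicalClosure_minimal _ (fun y hy => ?_)
      (Submodule.isClosed_topologicalClosure _))
  · obtain ⟨y, h⟩ := mem_ran.1 hz
    obtain ⟨x, -, h⟩ := mem_graph_comp.1 h
    exact mem_ran_of_mem_graph h
  obtain ⟨x, hx⟩ := mem_ran.1 hy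
  refine Metric.mem_closure_iff.2 fun ε hε => ?_
  -- If (T + r) u = x and v = t u, then y - r v = t t* v lies in the smaller range, with error ‖r
  -- v‖² ≤ r ‖x‖².
  obtain ⟨r, hr, hrε⟩ : ∃ r : ℝ, 0 < r ∧ r * ‖x‖ ^ 2 < ε ^ 2 := by
    refine ⟨ε ^ 2 / (‖x‖ ^ 2 + 1), by positivity, ?_⟩
    rw [div_mul_eq_mul_div, div_lt_iff₀ (by positivity)]
    nlinarith [pow_pos hε 2]
  obtain ⟨u, u', hu, hx'⟩ := ht.isPositiveOperator.isOnto_of_pos ht.isOnto_one hr x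
  obtain ⟨v, hv, hv'⟩ := mem_graph_comp.1 hu
  have hu' := graph_sub hx (graph_smul (r : ℂ) hv)
  rw [← hx', add_sub_cancel_right] at hu'
  refine ⟨y - (r : ℂ) • v, mem_ran_of_mem_graph (mem_graph_comp.2 ⟨u', hv', hu'⟩), ?_⟩
  rw [dist_eq_norm, sub_sub_cancel, norm_smul, Complex.norm_real, Real.norm_of_nonneg hr.le]
  have h₁ : r * ‖u‖ ≤ ‖x‖ := by
    have := ht.isPositiveOperator.norm_mul_le (z := r) (by simpa using hr.le) hu
    rwa [hx', Complex.norm_real, Real.norm_of_nonneg hr.le] at this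
  have key : inner A v v ≤ inner A u x := by
    rw [← hx', CStarModule.inner_add_right, CStarModule.inner_smul_right_complex,
      Complex.coe_smul, ht.inner_eq hv hv']
    exact le_add_of_nonneg_right (smul_nonneg hr.le CStarModule.inner_self_nonneg)
  have h₂ : ‖v‖ ^ 2 ≤ ‖u‖ * ‖x‖ := by
    have := CStarAlgebra.norm_le_norm_of_nonneg_of_le CStarModule.inner_self_nonneg key
    rw [← CStarModule.norm_sq_eq A] at this
    exact this.trans (CStarModule.norm_inner_le X)
  refine lt_of_pow_lt_pow_left₀ 2 hε.le (lt_of_le_of_lt ?_ hrε)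
  calc (r * ‖v‖) ^ 2 = r ^ 2 * ‖v‖ ^ 2 := by ring
    _ ≤ r ^ 2 * (‖u‖ * ‖x‖) := by gcongr
    _ = r * ((r * ‖u‖) * ‖x‖) := by ring
    _ ≤ r * (‖x‖ * ‖x‖) := by gcongr
    _ = r * ‖x‖ ^ 2 := by ring

end Modulus

/-! ### Operators with complemented ranges -/

section MoorePenrose

variable {A : Type*} {X Y : Type*} [NonUnitalCStarAlgebra A] [PartialOrder A] [StarOrderedRing A]
  [NormedAddCommGroup X] [NormedSpace ℂ X] [SMul A X] [CStarModule A X] [CompleteSpace X]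
  [NormedAddCommGroup Y] [NormedSpace ℂ Y] [SMul A Y] [CStarModule A Y] [CompleteSpace Y]

/-- A densely defined restriction of a bounded symmetric operator `P` has closure and adjoint
equal to `P`. -/
theorem adjoint_eq_closure_of_bounded {f : X →ₗ.[ℂ] X} {P : X →L[ℂ] X}
    (hP : ∀ x y, inner A (P x) y = inner A x (P y)) (hf : Dense (f.domain : Set X))
    (hfP : ∀ x y, (x, y) ∈ f.graph → y = P x) : adjoint A f = f.closure := by
  let p : X →ₗ.[ℂ] X := (P : X →ₗ[ℂ] X).toPMap ⊤
  have hp : ∀ x y, (x, y) ∈ p.graph ↔ y = P x := by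
    intro x y
    rw [LinearPMap.mem_graph_iff]
    exact ⟨fun ⟨u, hu, hy⟩ => hy.symm.trans (congrArg P hu), fun h => ⟨⟨x, trivial⟩, rfl, h.symm⟩⟩
  have hpc : p.IsClosed := by
    have : (p.graph : Set (X × X)) = {q | q.2 = P q.1} := by ext ⟨x, y⟩; exact hp x y
    rw [LinearPMap.IsClosed, this]
    exact isClosed_eq continuous_snd (P.continuous.comp continuous_fst)
  have hle : f ≤ p := le_of_graph fun x y h => (hp x y).2 (hfP x y h)
  have h₁ : adjoint A f = p := by
    refine graph_ext fun y z => ?_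
    rw [mem_graph_adjoint_iff A hf, hp]
    constructor
    · intro h
      have h0 : ∀ u : X, inner A u (P y - z) = 0 := by
        refine fun u => congrFun ((continuous_inner_left A (P y - z)).ext_on hf
          (continuous_const (y := (0 : A))) fun u hu => ?_) u
        obtain ⟨v, hv⟩ := LinearPMap.mem_domain_iff.1 hu
        have := h u v hv
        rw [hfP u v hv, hP] at this
        simp only [CStarModule.inner_sub_right, this, sub_self]
      exact (sub_eq_zero.1 (CStarModule.inner_self.1 (h0 _))).symm
    · rintro rfl u v huv
      rw [hfP u v huv, hP]
  have h₂ : f.closure = p := by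
    have hcl := hpc.isClosable.leIsClosable hle
    refine LinearPMap.eq_of_eq_graph ?_
    rw [← hcl.graph_closure_eq_closure_graph]
    refine le_antisymm (Submodule.topologicalClosure_minimal _ (LinearPMap.le_graph_of_le hle) hpc)
      ?_
    rintro ⟨x, y⟩ hxy
    obtain rfl := (hp x y).1 hxy
    have hcont : Continuous fun x : X => (x, P x) := by fun_prop
    refine closure_mono ?_ (image_closure_subset_closure_image hcont
      ⟨x, hf x, rfl⟩ : _ ∈ closure ((fun x : X => (x, P x)) '' (f.domain : Set X)))
    rintro _ ⟨u, hu, rfl⟩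
    obtain ⟨v, hv⟩ := LinearPMap.mem_domain_iff.1 hu
    obtain rfl := hfP u v hv
    exact hv
  rw [h₁, h₂]

theorem IsRegular.mem_graph_adjoint_zero {t : X →ₗ.[ℂ] Y} (ht : IsRegular A t) {y : Y} :
    (y, (0 : X)) ∈ (HilbertModule.adjoint A t).graph ↔ y ∈ orthogonal A (ran t) := by
  rw [mem_graph_adjoint_iff A ht.dense_domain, mem_orthogonal]
  simp only [CStarModule.inner_zero_right, mem_ran]
  exact ⟨fun h w ⟨x, hx⟩ => h x w hx, fun h u v huv => h v ⟨u, huv⟩⟩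

theorem IsRegular.mem_graph_zero {t : X →ₗ.[ℂ] Y} (ht : IsRegular A t) {x : X} :
    (x, (0 : Y)) ∈ t.graph ↔ x ∈ orthogonal A (ran (HilbertModule.adjoint A t)) := by
  rw [← ht.adjoint.mem_graph_adjoint_zero, ht.adjoint_adjoint]

variable (A) in
/-- `t` is regular and the closures of the ranges of `t` and `t*` are orthogonal summands. -/
structure HasComplementedRanges (t : X →ₗ.[ℂ] Y) : Prop where
  regular : IsRegular A t
  compl_ran_adjoint :
    IsOrthogonallyComplemented A (ran (HilbertModule.adjoint A t)).topologicalClosure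
  compl_ran : IsOrthogonallyComplemented A (ran t).topologicalClosure

namespace HasComplementedRanges

variable {t : X →ₗ.[ℂ] Y}

theorem adjoint (ht : HasComplementedRanges A t) :
    HasComplementedRanges A (HilbertModule.adjoint A t) where
  regular := ht.regular.adjoint
  compl_ran_adjoint := by rw [ht.regular.adjoint_adjoint]; exact ht.compl_ran
  compl_ran := ht.compl_ran_adjoint

theorem comp_self_adjoint (ht : HasComplementedRanges A t) :
    HasComplementedRanges A (comp t (HilbertModule.adjoint A t)) where
  regular := ht.regular.comp_self_adjoint
  compl_ran_adjoint := by
    rw [ht.regular.adjoint_comp_self_adjoint, ht.regular.topologicalClosure_ran_comp]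
    exact ht.compl_ran
  compl_ran := by
    rw [ht.regular.topologicalClosure_ran_comp]
    exact ht.compl_ran

theorem comp_adjoint_self (ht : HasComplementedRanges A t) :
    HasComplementedRanges A (comp (HilbertModule.adjoint A t) t) := by
  have := ht.adjoint.comp_self_adjoint
  rwa [ht.regular.adjoint_adjoint] at this

/-- The component of `x ∈ Dom t` in the closure of `Ran t*`. -/
theorem exists_graph_of_graph (ht : HasComplementedRanges A t) {x : X} {y : Y}
    (h : (x, y) ∈ t.graph) : ∃ u ∈ (ran (HilbertModule.adjoint A t)).topologicalClosure,
      (u, y) ∈ t.graph ∧ x - u ∈ orthogonal A (ran (HilbertModule.adjoint A t)) := by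
  obtain ⟨P, hP⟩ := ht.compl_ran_adjoint.exists_projection
  refine ⟨P x, (hP x).1, ?_, (hP x).2⟩
  simpa using graph_sub h (ht.regular.mem_graph_zero.2 (hP x).2)

end HasComplementedRanges

/-! ### The explicit inverse and its regularity -/

variable (A) in
/-- The pairs `(t x + z, x)` with `x ∈ Dom t` in the closure of `Ran t*` and `z ⊥ Ran t`. -/
noncomputable def pseudoInverseGraph (t : X →ₗ.[ℂ] Y) : Submodule ℂ (Y × X) where
  carrier := {p | p.2 ∈ (ran (adjoint A t)).topologicalClosure ∧
    ∃ w, (p.2, w) ∈ t.graph ∧ p.1 - w ∈ orthogonal A (ran t)}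
  add_mem' := by
    rintro p q ⟨hp, w, hw, hpw⟩ ⟨hq, v, hv, hqv⟩
    refine ⟨add_mem hp hq, w + v, graph_add hw hv, ?_⟩
    rw [Prod.fst_add, add_sub_add_comm]
    exact add_mem hpw hqv
  zero_mem' := ⟨zero_mem _, 0, graph_zero t, by simp [zero_mem]⟩
  smul_mem' := by
    rintro c p ⟨hp, w, hw, hpw⟩
    refine ⟨Submodule.smul_mem _ c hp, c • w, graph_smul c hw, ?_⟩
    rw [Prod.smul_fst, ← smul_sub]
    exact Submodule.smul_mem _ c hpw

variable (A) in
/-- The operator `t x + z ↦ x` for `x ∈ Dom t` in the closure of `Ran t*` and `z ⊥ Ran t`. -/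
noncomputable def pseudoInverse (t : X →ₗ.[ℂ] Y) : Y →ₗ.[ℂ] X :=
  (pseudoInverseGraph A t).toLinearPMap

namespace HasComplementedRanges

variable {t : X →ₗ.[ℂ] Y}

/-- The relation is single-valued: if t x + z = 0, then t x is in Ran t and orthogonal to it, so x
lies in Ker t = (Ran t*)^⊥ as well as in cl Ran t*. -/
theorem mem_graph_pseudoInverse (ht : HasComplementedRanges A t) {y : Y} {x : X} :
    (y, x) ∈ (pseudoInverse A t).graph ↔
      x ∈ (ran (HilbertModule.adjoint A t)).topologicalClosure ∧
        ∃ w, (x, w) ∈ t.graph ∧ y - w ∈ orthogonal A (ran t) := by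
  rw [pseudoInverse, Submodule.toLinearPMap_graph_eq]
  · rfl
  rintro ⟨y, x⟩ ⟨hx, w, hw, hyw⟩ (rfl : y = 0)
  dsimp only at hx hw hyw ⊢
  rw [zero_sub, neg_mem_iff] at hyw
  obtain rfl : w = 0 := eq_zero_of_mem_orthogonal A hyw (mem_ran_of_mem_graph hw)
  refine eq_of_sub_mem_orthogonal A hx (zero_mem _) ?_
  rw [sub_zero]
  exact ht.regular.mem_graph_zero.1 hw

/-- The domain contains Ran t + (Ran t)^⊥. -/
theorem dense_domain_pseudoInverse (ht : HasComplementedRanges A t) :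
    Dense ((pseudoInverse A t).domain : Set Y) := by
  intro y
  obtain ⟨P, hP⟩ := ht.compl_ran.exists_projection
  rw [← add_sub_cancel (P y) y]
  have hc : IsClosed {w : Y | w + (y - P y) ∈ closure ((pseudoInverse A t).domain : Set Y)} :=
    isClosed_closure.preimage (by fun_prop)
  refine closure_minimal ?_ hc (hP y).1
  intro w hw
  obtain ⟨x, hx⟩ := mem_ran.1 hw
  obtain ⟨u, hu, huw, -⟩ := ht.exists_graph_of_graph hx
  refine subset_closure (LinearPMap.mem_domain_of_mem_graph (y := u) ?_)
  exact ht.mem_graph_pseudoInverse.2 ⟨hu, w, huw, by simpa using (hP y).2⟩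

/-- With P the projection onto cl Ran t, the graph is cut out by the closed conditions x ∈ cl Ran t*
and t x = P y. -/
theorem isClosed_pseudoInverse (ht : HasComplementedRanges A t) :
    (pseudoInverse A t).IsClosed := by
  obtain ⟨P, hP⟩ := ht.compl_ran.exists_projection
  have : ((pseudoInverse A t).graph : Set (Y × X)) =
      {p | p.2 ∈ (ran (HilbertModule.adjoint A t)).topologicalClosure} ∩
        {p | (p.2, P p.1) ∈ t.graph} := by
    ext ⟨y, x⟩
    refine ht.mem_graph_pseudoInverse.trans (and_congr_right fun hx => ⟨?_, fun h => ?_⟩)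
    · rintro ⟨w, hw, hyw⟩
      have h0 : P y - w ∈ orthogonal A (ran t) := by
        simpa using sub_mem hyw (hP y).2
      change (x, P y) ∈ t.graph
      rwa [eq_of_sub_mem_orthogonal A (hP y).1
        (Submodule.le_topologicalClosure _ (mem_ran_of_mem_graph hw)) h0]
    · exact ⟨P y, h, (hP y).2⟩
  rw [LinearPMap.IsClosed, this]
  exact ((Submodule.isClosed_topologicalClosure _).preimage continuous_snd).inter
    (ht.regular.isClosed.preimage (by fun_prop))

/-- The Moore-Penrose inverse of `t*` is contained in the adjoint of that of `t`. -/
theorem graph_adjoint_pseudoInverse (ht : HasComplementedRanges A t) {x : X} {y : Y}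
    (h : (x, y) ∈ (pseudoInverse A (HilbertModule.adjoint A t)).graph) :
    (x, y) ∈ (HilbertModule.adjoint A (pseudoInverse A t)).graph := by
  rw [mem_graph_adjoint_iff A ht.dense_domain_pseudoInverse]
  obtain ⟨hy, v, hv, hxv⟩ := ht.adjoint.mem_graph_pseudoInverse.1 h
  rw [ht.regular.adjoint_adjoint] at hy
  intro y' x' h'
  obtain ⟨hx', w, hw, hyw⟩ := ht.mem_graph_pseudoInverse.1 h'
  have h₁ : inner A x' (x - v) = 0 := by
    refine inner_left_of_mem_orthogonal A (W := orthogonal A _) (fun k hk => ?_) hxv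
    exact (ht.compl_ran_adjoint.mem_topologicalClosure_iff A).1 hx' k hk
  have h₂ : inner A (y' - w) y = 0 := (ht.compl_ran.mem_topologicalClosure_iff A).1 hy _ hyw
  rw [CStarModule.inner_sub_right, sub_eq_zero] at h₁
  rw [CStarModule.inner_sub_left, sub_eq_zero] at h₂
  rw [h₁, h₂, ht.regular.inner_eq hw hv]

theorem isRegular_pseudoInverse (ht : HasComplementedRanges A t) :
    IsRegular A (pseudoInverse A t) where
  moduleLinear := by
    rw [isModuleLinear_iff]
    intro a y x h
    obtain ⟨hx, w, hw, hyw⟩ := ht.mem_graph_pseudoInverse.1 h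
    refine ht.mem_graph_pseudoInverse.2 ⟨?_, a • w,
      (isModuleLinear_iff A).1 ht.regular.moduleLinear a x w hw, fun v hv => ?_⟩
    · rw [ht.compl_ran_adjoint.mem_topologicalClosure_iff] at hx ⊢
      intro k hk
      rw [CStarModule.inner_op_smul_right, hx k hk, mul_zero]
    · have := hyw v hv
      rw [CStarModule.inner_sub_right] at this ⊢
      rw [CStarModule.inner_op_smul_right, CStarModule.inner_op_smul_right, ← mul_sub, this,
        mul_zero]
  dense_domain := ht.dense_domain_pseudoInverse
  isClosed := ht.isClosed_pseudoInverse
  dense_adjoint_domain := by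
    refine ht.adjoint.dense_domain_pseudoInverse.mono fun x hx => ?_
    obtain ⟨y, hy⟩ := LinearPMap.mem_domain_iff.1 hx
    exact LinearPMap.mem_domain_of_mem_graph (ht.graph_adjoint_pseudoInverse hy)
  dense_range := by
    refine dense_range_one_add_of_forall fun y => ?_
    obtain ⟨P, hP⟩ := ht.compl_ran.exists_projection
    -- Solve v + t t* v = P y. The inverse sends t t* v + (y - P y) to t* v, its adjoint sends t* v
    -- to v, and the two ends add up to y.
    obtain ⟨v, w, h, hvw⟩ := ht.regular.adjoint.exists_add_eq (P y)
    rw [ht.regular.adjoint_adjoint] at h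
    obtain ⟨u, hu, huw⟩ := mem_graph_comp.1 h
    refine ⟨w + (y - P y), v, mem_graph_comp.2 ⟨u, ?_, ht.graph_adjoint_pseudoInverse ?_⟩, ?_⟩
    · refine ht.mem_graph_pseudoInverse.2 ⟨Submodule.le_topologicalClosure _
        (mem_ran_of_mem_graph hu), w, huw, ?_⟩
      simpa using (hP y).2
    · refine ht.adjoint.mem_graph_pseudoInverse.2 ⟨?_, u, hu, by simp [zero_mem]⟩
      rw [ht.regular.adjoint_adjoint, eq_sub_of_add_eq hvw]
      exact sub_mem (hP y).1 (Submodule.le_topologicalClosure _ (mem_ran_of_mem_graph huw))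
    · rw [← hvw]; abel

theorem graph_pseudoInverse_of_graph (ht : HasComplementedRanges A t) {x : X} {y : Y}
    (hx : x ∈ (ran (HilbertModule.adjoint A t)).topologicalClosure) (h : (x, y) ∈ t.graph) :
    (y, x) ∈ (pseudoInverse A t).graph :=
  ht.mem_graph_pseudoInverse.2 ⟨hx, y, h, by simp [zero_mem]⟩

/-- `t s` is a restriction of the projection onto the closure of `Ran t`. -/
theorem graph_comp_pseudoInverse (ht : HasComplementedRanges A t) {y z : Y}
    (h : (y, z) ∈ (comp t (pseudoInverse A t)).graph) :
    z ∈ ran t ∧ y - z ∈ orthogonal A (ran t) := by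
  obtain ⟨x, h₁, h₂⟩ := mem_graph_comp.1 h
  obtain ⟨-, w, hw, hyw⟩ := ht.mem_graph_pseudoInverse.1 h₁
  obtain rfl := LinearPMap.mem_graph_snd_inj t hw h₂ rfl
  exact ⟨mem_ran_of_mem_graph hw, hyw⟩

/-- `s t` is a restriction of the projection onto the closure of `Ran t*`. -/
theorem graph_pseudoInverse_comp (ht : HasComplementedRanges A t) {x u : X}
    (h : (x, u) ∈ (comp (pseudoInverse A t) t).graph) :
    u ∈ (ran (HilbertModule.adjoint A t)).topologicalClosure ∧
      x - u ∈ orthogonal A (ran (HilbertModule.adjoint A t)) := by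
  obtain ⟨y, h₁, h₂⟩ := mem_graph_comp.1 h
  obtain ⟨v, hv, hvy, hxv⟩ := ht.exists_graph_of_graph h₁
  obtain rfl := LinearPMap.mem_graph_snd_inj _ h₂ (ht.graph_pseudoInverse_of_graph hv hvy) rfl
  exact ⟨hv, hxv⟩

end HasComplementedRanges

/-- A densely defined restriction of an orthogonal projection has the same adjoint and closure. -/
theorem adjoint_eq_closure_of_projection {W : Submodule ℂ X}
    (hW : IsOrthogonallyComplemented A W.topologicalClosure) {f : X →ₗ.[ℂ] X}
    (hf : Dense (f.domain : Set X))
    (h : ∀ x y, (x, y) ∈ f.graph → y ∈ W.topologicalClosure ∧ x - y ∈ orthogonal A W) :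
    adjoint A f = f.closure := by
  obtain ⟨P, hP⟩ := hW.exists_projection
  have horth : ∀ {x y}, x ∈ orthogonal A W → y ∈ W.topologicalClosure → inner A x y = 0 :=
    fun {x y} hx hy => (hW.mem_topologicalClosure_iff A).1 hy x hx
  refine adjoint_eq_closure_of_bounded (P := P) (fun x y => ?_) hf fun x y hxy => ?_
  · have h₁ := horth (hP x).2 (hP y).1
    have h₂ : inner A (P x) (y - P y) = 0 := by
      rw [← CStarModule.star_inner (y - P y), horth (hP y).2 (hP x).1, star_zero]
    rw [CStarModule.inner_sub_left, sub_eq_zero] at h₁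
    rw [CStarModule.inner_sub_right, sub_eq_zero] at h₂
    rw [h₁, h₂]
  · obtain ⟨h₁, h₂⟩ := h x y hxy
    exact eq_of_sub_mem_orthogonal A h₁ (hP x).1 (by simpa using sub_mem (hP x).2 h₂)

namespace HasComplementedRanges

variable {t : X →ₗ.[ℂ] Y}

theorem isMoorePenroseInverse_pseudoInverse (ht : HasComplementedRanges A t) :
    IsMoorePenroseInverse A t (pseudoInverse A t) where
  regular_left := ht.regular
  regular_right := ht.isRegular_pseudoInverse
  comp_comp_left := by
    refine graph_ext fun x y => ⟨fun h => ?_, fun h => ?_⟩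
    · obtain ⟨u, h₁, h₂⟩ := mem_graph_comp.1 h
      obtain ⟨-, h₃⟩ := ht.graph_pseudoInverse_comp h₁
      simpa using graph_add (ht.regular.mem_graph_zero.2 h₃) h₂
    · obtain ⟨u, hu, huy, -⟩ := ht.exists_graph_of_graph h
      exact mem_graph_comp.2
        ⟨u, mem_graph_comp.2 ⟨y, h, ht.graph_pseudoInverse_of_graph hu huy⟩, huy⟩
  comp_comp_right := by
    refine graph_ext fun y x => ⟨fun h => ?_, fun h => ?_⟩
    · obtain ⟨w, h₁, h₂⟩ := mem_graph_comp.1 h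
      obtain ⟨-, h₃⟩ := ht.graph_comp_pseudoInverse h₁
      have h₄ : (y - w, (0 : X)) ∈ (pseudoInverse A t).graph :=
        ht.mem_graph_pseudoInverse.2 ⟨zero_mem _, 0, graph_zero t, by simpa using h₃⟩
      simpa using graph_add h₄ h₂
    · obtain ⟨hx, w, hw, -⟩ := ht.mem_graph_pseudoInverse.1 h
      exact mem_graph_comp.2
        ⟨w, mem_graph_comp.2 ⟨x, h, hw⟩, ht.graph_pseudoInverse_of_graph hx hw⟩
  adjoint_left := by
    refine adjoint_eq_closure_of_projection ht.compl_ran ?_ fun y z h => ?_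
    · refine ht.dense_domain_pseudoInverse.mono fun y hy => ?_
      obtain ⟨x, hx⟩ := LinearPMap.mem_domain_iff.1 hy
      obtain ⟨-, w, hw, -⟩ := ht.mem_graph_pseudoInverse.1 hx
      exact LinearPMap.mem_domain_of_mem_graph (mem_graph_comp.2 ⟨x, hx, hw⟩)
    · obtain ⟨h₁, h₂⟩ := ht.graph_comp_pseudoInverse h
      exact ⟨Submodule.le_topologicalClosure _ h₁, h₂⟩
  adjoint_right := by
    refine adjoint_eq_closure_of_projection ht.compl_ran_adjoint ?_
      fun y z h => ht.graph_pseudoInverse_comp h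
    refine ht.regular.dense_domain.mono fun x hx => ?_
    obtain ⟨y, hy⟩ := LinearPMap.mem_domain_iff.1 hx
    obtain ⟨u, hu, huy, -⟩ := ht.exists_graph_of_graph hy
    exact LinearPMap.mem_domain_of_mem_graph
      (mem_graph_comp.2 ⟨y, hy, ht.graph_pseudoInverse_of_graph hu huy⟩)

end HasComplementedRanges

/-! ### Uniqueness of the Moore-Penrose inverse -/

theorem inner_eq_of_adjoint_eq_closure {f : X →ₗ.[ℂ] X} (hf : Dense (f.domain : Set X))
    (h : adjoint A f = f.closure) {x x' y y' : X} (hx : (x, x') ∈ f.graph)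
    (hy : (y, y') ∈ f.graph) : inner A x' y = inner A x y' := by
  have : (y, y') ∈ (adjoint A f).graph := by
    rw [h]; exact LinearPMap.le_graph_of_le f.le_closure hy
  exact (mem_graph_adjoint_iff A hf).1 this x x' hx

/-- The Moore-Penrose inverse is unique. -/
theorem IsMoorePenroseInverse.eq_pseudoInverse {t : X →ₗ.[ℂ] Y} {s : Y →ₗ.[ℂ] X}
    (h : IsMoorePenroseInverse A t s) (ht : HasComplementedRanges A t) :
    s = pseudoInverse A t := by
  -- The identity t s t = t also says that s t is defined on Dom t and maps it into itself.
  have hst : ∀ {x y}, (x, y) ∈ t.graph → ∃ u, (y, u) ∈ s.graph ∧ (u, y) ∈ t.graph := by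
    intro x y hxy
    rw [← h.comp_comp_left] at hxy
    obtain ⟨u, h₁, h₂⟩ := mem_graph_comp.1 hxy
    obtain ⟨w, h₃, h₄⟩ := mem_graph_comp.1 h₁
    have h₅ : (x, y) ∈ t.graph := by rw [← h.comp_comp_left]; exact hxy
    obtain rfl := LinearPMap.mem_graph_snd_inj t h₃ h₅ rfl
    exact ⟨u, h₄, h₂⟩
  have hts : ∀ {y x}, (y, x) ∈ s.graph → ∃ w, (x, w) ∈ t.graph ∧ (w, x) ∈ s.graph := by
    intro y x hyx
    rw [← h.comp_comp_right] at hyx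
    obtain ⟨w, h₁, h₂⟩ := mem_graph_comp.1 hyx
    obtain ⟨u, h₃, h₄⟩ := mem_graph_comp.1 h₁
    have h₅ : (y, x) ∈ s.graph := by rw [← h.comp_comp_right]; exact hyx
    obtain rfl := LinearPMap.mem_graph_snd_inj s h₃ h₅ rfl
    exact ⟨w, h₄, h₂⟩
  have hd₁ : Dense ((comp t s).domain : Set Y) := by
    refine h.regular_right.dense_domain.mono fun y hy => ?_
    obtain ⟨x, hx⟩ := LinearPMap.mem_domain_iff.1 hy
    obtain ⟨w, hw, -⟩ := hts hx
    exact LinearPMap.mem_domain_of_mem_graph (mem_graph_comp.2 ⟨x, hx, hw⟩)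
  have hd₂ : Dense ((comp s t).domain : Set X) := by
    refine h.regular_left.dense_domain.mono fun x hx => ?_
    obtain ⟨y, hy⟩ := LinearPMap.mem_domain_iff.1 hx
    obtain ⟨u, hu, -⟩ := hst hy
    exact LinearPMap.mem_domain_of_mem_graph (mem_graph_comp.2 ⟨y, hy, hu⟩)
  -- t s is symmetric and fixes Ran t pointwise.
  have horth : ∀ {y x w}, (y, x) ∈ s.graph → (x, w) ∈ t.graph → y - w ∈ orthogonal A (ran t) := by
    intro y x w hyx hxw v hv
    obtain ⟨z, hz⟩ := mem_ran.1 hv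
    obtain ⟨u, hu, huv⟩ := hst hz
    rw [CStarModule.inner_sub_right, sub_eq_zero]
    exact inner_eq_of_adjoint_eq_closure hd₁ h.adjoint_left (mem_graph_comp.2 ⟨u, hu, huv⟩)
      (mem_graph_comp.2 ⟨x, hyx, hxw⟩)
  -- By symmetry Ran (s t) is orthogonal to Ker t, and (Ker t)^⊥ = cl Ran t*.
  have hran : ∀ {x y u}, (x, y) ∈ t.graph → (y, u) ∈ s.graph →
      u ∈ (ran (adjoint A t)).topologicalClosure := by
    intro x y u hxy hyu
    rw [ht.compl_ran_adjoint.mem_topologicalClosure_iff]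
    intro k hk
    have hk0 := mem_graph_comp.2 ⟨0, ht.regular.mem_graph_zero.2 hk, graph_zero s⟩
    rw [← inner_eq_of_adjoint_eq_closure hd₂ h.adjoint_right hk0
      (mem_graph_comp.2 ⟨y, hxy, hyu⟩), CStarModule.inner_zero_left]
  obtain ⟨P, hP⟩ := ht.compl_ran.exists_projection
  -- On Dom s, y - P y = y - t s y is killed by s; closedness of s extends this to all y.
  have hker : ∀ {z}, z ∈ orthogonal A (ran t) → (z, (0 : X)) ∈ s.graph := by
    intro z hz
    have hproj : ∀ {y w}, w ∈ ran t → y - w ∈ orthogonal A (ran t) → P y = w := by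
      intro y w hw hyw
      exact eq_of_sub_mem_orthogonal A (hP y).1 (Submodule.le_topologicalClosure _ hw)
        (by simpa using sub_mem hyw (hP y).2)
    have hc : IsClosed {y : Y | (y - P y, (0 : X)) ∈ s.graph} :=
      h.regular_right.isClosed.preimage (by fun_prop)
    have hmem : z ∈ {y : Y | (y - P y, (0 : X)) ∈ s.graph} := by
      refine closure_minimal (fun y hy => ?_) hc (h.regular_right.dense_domain z)
      obtain ⟨x, hx⟩ := LinearPMap.mem_domain_iff.1 hy
      obtain ⟨w, hw, hwx⟩ := hts hx
      change (y - P y, (0 : X)) ∈ s.graph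
      rw [hproj (mem_ran_of_mem_graph hw) (horth hx hw)]
      simpa using graph_sub hx hwx
    have hPz : P z = 0 := hproj (zero_mem _) (by simpa using hz)
    change (z - P z, (0 : X)) ∈ s.graph at hmem
    rwa [hPz, sub_zero] at hmem
  refine graph_ext fun y x => ⟨fun hyx => ?_, fun hyx => ?_⟩
  · obtain ⟨w, hw, hwx⟩ := hts hyx
    exact ht.mem_graph_pseudoInverse.2 ⟨hran hw hwx, w, hw, horth hyx hw⟩
  · obtain ⟨hx, w, hw, hyw⟩ := ht.mem_graph_pseudoInverse.1 hyx
    obtain ⟨u, hu, huw⟩ := hst hw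
    have hxu : (x - u, (0 : Y)) ∈ t.graph := by simpa using graph_sub hw huw
    obtain rfl := eq_of_sub_mem_orthogonal A hx (hran hw hu) (ht.regular.mem_graph_zero.1 hxu)
    simpa using graph_add (hker hyw) hu

/-! ### The relations between the three inverses -/

namespace HasComplementedRanges

variable {t : X →ₗ.[ℂ] Y}

theorem existsUnique (ht : HasComplementedRanges A t) :
    ∃! s : Y →ₗ.[ℂ] X, IsMoorePenroseInverse A t s :=
  ⟨_, ht.isMoorePenroseInverse_pseudoInverse, fun _ hs => hs.eq_pseudoInverse ht⟩

theorem moorePenroseInverse_eq (ht : HasComplementedRanges A t) :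
    moorePenroseInverse A t = pseudoInverse A t :=
  (moorePenroseInverse_spec A ht.existsUnique).eq_pseudoInverse ht

theorem mem_graph_moorePenroseInverse (ht : HasComplementedRanges A t) {y : Y} {x : X} :
    (y, x) ∈ (moorePenroseInverse A t).graph ↔
      x ∈ (ran (HilbertModule.adjoint A t)).topologicalClosure ∧
        ∃ w, (x, w) ∈ t.graph ∧ y - w ∈ orthogonal A (ran t) := by
  rw [ht.moorePenroseInverse_eq, ht.mem_graph_pseudoInverse]

theorem orthogonal_ran_comp (ht : HasComplementedRanges A t) :
    orthogonal A (ran (comp t (HilbertModule.adjoint A t))) = orthogonal A (ran t) := by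
  rw [← orthogonal_topologicalClosure, ht.regular.topologicalClosure_ran_comp,
    orthogonal_topologicalClosure]

theorem mem_graph_moorePenroseInverse_comp_self_adjoint (ht : HasComplementedRanges A t)
    {y z : Y} :
    (y, z) ∈ (moorePenroseInverse A (comp t (HilbertModule.adjoint A t))).graph ↔
      z ∈ (ran t).topologicalClosure ∧
        ∃ w, (z, w) ∈ (comp t (HilbertModule.adjoint A t)).graph ∧
          y - w ∈ orthogonal A (ran t) := by
  rw [ht.comp_self_adjoint.mem_graph_moorePenroseInverse, ht.orthogonal_ran_comp,
    ht.regular.adjoint_comp_self_adjoint, ht.regular.topologicalClosure_ran_comp]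

theorem mem_graph_moorePenroseInverse_comp_adjoint_self (ht : HasComplementedRanges A t)
    {x z : X} :
    (x, z) ∈ (moorePenroseInverse A (comp (HilbertModule.adjoint A t) t)).graph ↔
      z ∈ (ran (HilbertModule.adjoint A t)).topologicalClosure ∧
        ∃ w, (z, w) ∈ (comp (HilbertModule.adjoint A t) t).graph ∧
          x - w ∈ orthogonal A (ran (HilbertModule.adjoint A t)) := by
  have := ht.adjoint.mem_graph_moorePenroseInverse_comp_self_adjoint (y := x) (z := z)
  rwa [ht.regular.adjoint_adjoint] at this

theorem adjoint_comp_moorePenroseInverse_le (ht : HasComplementedRanges A t) :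
    comp (HilbertModule.adjoint A t)
      (moorePenroseInverse A (comp t (HilbertModule.adjoint A t))) ≤ moorePenroseInverse A t := by
  refine le_of_graph fun y x h => ?_
  obtain ⟨z, hz, hzx⟩ := mem_graph_comp.1 h
  obtain ⟨-, w, hw, hyw⟩ := ht.mem_graph_moorePenroseInverse_comp_self_adjoint.1 hz
  obtain ⟨x', hx', hxw⟩ := mem_graph_comp.1 hw
  obtain rfl := LinearPMap.mem_graph_snd_inj _ hx' hzx rfl
  exact ht.mem_graph_moorePenroseInverse.2
    ⟨Submodule.le_topologicalClosure _ (mem_ran_of_mem_graph hx'), w, hxw, hyw⟩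

/-- t* y - t* t x lies in Ran t* and is orthogonal to it, so y - t x ∈ Ker t* = (Ran t)^⊥. No
condition on Ran t enters. -/
theorem moorePenroseInverse_comp_adjoint_le (ht : HasComplementedRanges A t) :
    comp (moorePenroseInverse A (comp (HilbertModule.adjoint A t) t))
      (HilbertModule.adjoint A t) ≤ moorePenroseInverse A t := by
  refine le_of_graph fun y x h => ?_
  obtain ⟨z, hz, hzx⟩ := mem_graph_comp.1 h
  obtain ⟨hx, w, hw, hzw⟩ := ht.mem_graph_moorePenroseInverse_comp_adjoint_self.1 hzx
  obtain ⟨v, hv, hvw⟩ := mem_graph_comp.1 hw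
  obtain rfl := eq_of_sub_mem_orthogonal A
    (Submodule.le_topologicalClosure _ (mem_ran_of_mem_graph hz))
    (Submodule.le_topologicalClosure _ (mem_ran_of_mem_graph hvw)) hzw
  refine ht.mem_graph_moorePenroseInverse.2 ⟨hx, v, hv, ?_⟩
  rw [← ht.regular.mem_graph_adjoint_zero]
  simpa using graph_sub hz hvw

/-- Ran t ⊆ Dom t† always, which forces the condition. Conversely y - t x ∈ Ker t*, so t* y = t* t x
as soon as t x ∈ Dom t*. -/
theorem le_moorePenroseInverse_comp_adjoint_iff (ht : HasComplementedRanges A t) :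
    moorePenroseInverse A t ≤
        comp (moorePenroseInverse A (comp (HilbertModule.adjoint A t) t))
          (HilbertModule.adjoint A t) ↔
      ran t ≤ (HilbertModule.adjoint A t).domain := by
  constructor
  · intro h y hy
    obtain ⟨x, hx⟩ := mem_ran.1 hy
    obtain ⟨u, hu, huy, -⟩ := ht.exists_graph_of_graph hx
    have := ht.graph_pseudoInverse_of_graph hu huy
    rw [← ht.moorePenroseInverse_eq] at this
    obtain ⟨z, hz, -⟩ := mem_graph_comp.1 (LinearPMap.le_graph_of_le h this)
    exact LinearPMap.mem_domain_of_mem_graph hz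
  · refine fun h => le_of_graph fun y x hyx => ?_
    obtain ⟨hx, w, hw, hyw⟩ := ht.mem_graph_moorePenroseInverse.1 hyx
    obtain ⟨z, hz⟩ := LinearPMap.mem_domain_iff.1 (h (mem_ran_of_mem_graph hw))
    refine mem_graph_comp.2 ⟨z, ?_, ?_⟩
    · simpa using graph_add (ht.regular.mem_graph_adjoint_zero.2 hyw) hz
    · exact ht.mem_graph_moorePenroseInverse_comp_adjoint_self.2
        ⟨hx, z, mem_graph_comp.2 ⟨w, hw, hz⟩, by simp [zero_mem]⟩

/-- If `t` has closed range, then so has `t*`. -/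
theorem mem_ran_adjoint_of_isClosed (ht : HasComplementedRanges A t)
    (hcl : IsClosed (ran t : Set Y)) {x : X}
    (hx : x ∈ (ran (HilbertModule.adjoint A t)).topologicalClosure) :
    x ∈ ran (HilbertModule.adjoint A t) := by
  set s := pseudoInverse A t with hs
  obtain ⟨P, hP⟩ := ht.compl_ran.exists_projection
  have hdom : ∀ y, ∃ x, (y, x) ∈ s.graph := by
    intro y
    have h₁ : P y ∈ ran t := closure_minimal subset_rfl hcl (hP y).1
    obtain ⟨z, hz⟩ := mem_ran.1 h₁
    obtain ⟨u, hu, huy, -⟩ := ht.exists_graph_of_graph hz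
    exact ⟨u, ht.mem_graph_pseudoInverse.2 ⟨hu, _, huy, (hP y).2⟩⟩
  choose S hS using hdom
  have hS' : ∀ {y x}, (y, x) ∈ s.graph → S y = x :=
    fun {y x} h => LinearPMap.mem_graph_snd_inj s (hS y) h rfl
  let B : Y →ₗ[ℂ] X :=
    { toFun := S
      map_add' := fun y z => hS' (graph_add (hS y) (hS z))
      map_smul' := fun c y => hS' (graph_smul c (hS y)) }
  have hB : Continuous B := by
    refine B.continuous_of_isClosed_graph ?_
    have : (B.graph : Set (Y × X)) = s.graph := by
      ext ⟨y, x⟩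
      refine ⟨?_, fun h => (hS' h).symm⟩
      rintro (rfl : x = S y)
      exact hS y
    rw [this]
    exact ht.isClosed_pseudoInverse
  obtain ⟨C, hC, hCB⟩ := (⟨B, hB⟩ : Y →L[ℂ] X).bound
  have hadj : ∀ {x z}, (x, z) ∈ (HilbertModule.adjoint A s).graph → ‖z‖ ≤ C * ‖x‖ := by
    intro x z h
    rw [mem_graph_adjoint_iff A ht.dense_domain_pseudoInverse] at h
    rcases (norm_nonneg z).eq_or_lt' with h0 | h0
    · rw [h0]; positivity
    refine le_of_mul_le_mul_left ?_ h0
    calc ‖z‖ * ‖z‖ = ‖(inner A z z : A)‖ := by rw [← CStarModule.norm_sq_eq A, sq]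
      _ = ‖(inner A (S z) x : A)‖ := by rw [h z (S z) (hS z)]
      _ ≤ ‖S z‖ * ‖x‖ := CStarModule.norm_inner_le X
      _ ≤ (C * ‖z‖) * ‖x‖ := by gcongr; exact hCB z
      _ = ‖z‖ * (C * ‖x‖) := by ring
  -- The adjoint of s is closed and bounded on a dense domain, hence defined everywhere.
  obtain ⟨z, hz⟩ : ∃ z, (x, z) ∈ (HilbertModule.adjoint A s).graph := by
    let G := (HilbertModule.adjoint A s).graph
    have hG : IsClosed (G : Set (X × Y)) := isClosed_adjoint A ht.dense_domain_pseudoInverse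
    have : CompleteSpace G := hG.completeSpace_coe
    let L : G →L[ℂ] X := ContinuousLinearMap.fst ℂ X Y ∘L G.subtypeL
    have hL : AntilipschitzWith (Real.toNNReal (max 1 C)) L := by
      refine L.antilipschitz_of_bound fun p => ?_
      rw [Real.coe_toNNReal _ (by positivity)]
      obtain ⟨⟨a, b⟩, hab⟩ := p
      refine max_le ?_ ((hadj hab).trans ?_)
      · exact le_mul_of_one_le_left (norm_nonneg _) (le_max_left _ _)
      · exact mul_le_mul_of_nonneg_right (le_max_right _ _) (norm_nonneg _)
    have hmem : x ∈ Set.range L := by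
      refine closure_minimal ?_ (hL.isClosed_range L.uniformContinuous)
        (ht.isRegular_pseudoInverse.dense_adjoint_domain x)
      intro a ha
      obtain ⟨b, hb⟩ := LinearPMap.mem_domain_iff.1 ha
      exact ⟨⟨(a, b), hb⟩, rfl⟩
    obtain ⟨⟨⟨a, b⟩, hab⟩, rfl⟩ := hmem
    exact ⟨b, hab⟩
  rw [mem_graph_adjoint_iff A ht.dense_domain_pseudoInverse] at hz
  refine mem_ran.2 ⟨z, (mem_graph_adjoint_iff A ht.regular.dense_domain).2 fun u v huv => ?_⟩
  -- z solves t* z = x: with w the component of u in cl Ran t*, ⟪t u, z⟫ = ⟪w, x⟫ = ⟪u, x⟫.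
  obtain ⟨w, hw, hwv, huw⟩ := ht.exists_graph_of_graph huv
  rw [← hz v w (ht.graph_pseudoInverse_of_graph hw hwv)]
  have h0 := (ht.compl_ran_adjoint.mem_topologicalClosure_iff A).1 hx _ huw
  rw [CStarModule.inner_sub_left, sub_eq_zero] at h0
  exact h0.symm

theorem adjoint_comp_moorePenroseInverse_eq (ht : HasComplementedRanges A t)
    (hcl : IsClosed (ran t : Set Y)) :
    comp (HilbertModule.adjoint A t)
      (moorePenroseInverse A (comp t (HilbertModule.adjoint A t))) = moorePenroseInverse A t := by
  refine le_antisymm ht.adjoint_comp_moorePenroseInverse_le (le_of_graph fun y x h => ?_)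
  obtain ⟨hx, w, hw, hyw⟩ := ht.mem_graph_moorePenroseInverse.1 h
  obtain ⟨z, hz⟩ := mem_ran.1 (ht.mem_ran_adjoint_of_isClosed hcl hx)
  -- Only the component of z in cl Ran t can be the value of (t t*)† at y; t* does not see the rest.
  obtain ⟨v, hv, hvx, -⟩ := ht.adjoint.exists_graph_of_graph hz
  rw [ht.regular.adjoint_adjoint] at hv
  exact mem_graph_comp.2 ⟨v, ht.mem_graph_moorePenroseInverse_comp_self_adjoint.2
    ⟨hv, w, mem_graph_comp.2 ⟨x, hvx, hw⟩, hyw⟩, hvx⟩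

end HasComplementedRanges

end MoorePenrose

end HilbertModule

theorem theorem2p2 {A X Y : Type*}
    [NonUnitalCStarAlgebra A] [PartialOrder A] [StarOrderedRing A]
    [NormedAddCommGroup X] [NormedSpace ℂ X] [SMul A X] [CStarModule A X] [CompleteSpace X]
    [NormedAddCommGroup Y] [NormedSpace ℂ Y] [SMul A Y] [CStarModule A Y] [CompleteSpace Y]
    (t : X →ₗ.[ℂ] Y) (ht : HilbertModule.IsRegular A t)
    (hX : HilbertModule.IsOrthogonallyComplemented A
      (HilbertModule.ran (HilbertModule.adjoint A t)).topologicalClosure)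
    (hY : HilbertModule.IsOrthogonallyComplemented A
      (HilbertModule.ran t).topologicalClosure) :
    -- the Moore-Penrose inverses of `t`, `t t*` and `t* t` exist and are unique
    ((∃! s : Y →ₗ.[ℂ] X, HilbertModule.IsMoorePenroseInverse A t s) ∧
      (∃! s : Y →ₗ.[ℂ] Y, HilbertModule.IsMoorePenroseInverse A
        (HilbertModule.comp t (HilbertModule.adjoint A t)) s) ∧
      (∃! s : X →ₗ.[ℂ] X, HilbertModule.IsMoorePenroseInverse A
        (HilbertModule.comp (HilbertModule.adjoint A t) t) s)) ∧
    -- (i)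
    HilbertModule.comp (HilbertModule.adjoint A t)
        (HilbertModule.moorePenroseInverse A
          (HilbertModule.comp t (HilbertModule.adjoint A t))) ≤
      HilbertModule.moorePenroseInverse A t ∧
    -- (ii)
    (HilbertModule.moorePenroseInverse A t ≤
        HilbertModule.comp
          (HilbertModule.moorePenroseInverse A
            (HilbertModule.comp (HilbertModule.adjoint A t) t))
          (HilbertModule.adjoint A t) ↔
      HilbertModule.ran t ≤ (HilbertModule.adjoint A t).domain) ∧
    -- (iii) and (iv), for closed range
    (IsClosed (HilbertModule.ran t : Set Y) →
      HilbertModule.comp (HilbertModule.adjoint A t)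
          (HilbertModule.moorePenroseInverse A
            (HilbertModule.comp t (HilbertModule.adjoint A t))) =
        HilbertModule.moorePenroseInverse A t ∧
      (HilbertModule.ran t ≤ (HilbertModule.adjoint A t).domain →
        HilbertModule.moorePenroseInverse A t =
          HilbertModule.comp
            (HilbertModule.moorePenroseInverse A
              (HilbertModule.comp (HilbertModule.adjoint A t) t))
            (HilbertModule.adjoint A t))) := by
  have h : HilbertModule.HasComplementedRanges A t := ⟨ht, hX, hY⟩
  exact ⟨⟨h.existsUnique, h.comp_self_adjoint.existsUnique, h.comp_adjoint_self.existsUnique⟩,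
    h.adjoint_comp_moorePenroseInverse_le, h.le_moorePenroseInverse_comp_adjoint_iff,
    fun hcl => ⟨h.adjoint_comp_moorePenroseInverse_eq hcl, fun hran =>
      le_antisymm (h.le_moorePenroseInverse_comp_adjoint_iff.2 hran)
        h.moorePenroseInverse_comp_adjoint_le⟩⟩
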